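/- Let $n\ge 2$, $0<\kappa<1$, $0<c_1<c_2$, let $\Omega\subseteq S^{n-1}$ be relatively open, $\Sigma\subset\mathbb R^n$, and $\Gamma=\{rx: x\in\Omega,\ c_1\le r\le c_2\}$. *Notation.* For $x\in S^{n-1}$, $Y,X_0\in\mathbb R^n$ put $b=|X_0|+\kappa|X_0-Y|$ and $$h(x,Y,X_0)=\frac{b-\kappa^2x\cdot Y-\sqrt{(b-\kappa^2x\cdot Y)^2-(1-\kappa^2)(b^2-\kappa^2|Y|^2)}}{1-\kappa^2},$$ the polar radius of the Descartes oval $\{X:|X|+\kappa|X-Y|=b\}$. For $x_0,\bar m,\hat m\in S^{n-1}$ with $\bar m\cdot x_0\ge\kappa$, $\hat m\cdot x_0\ge\kappa$, and $\lambda\in[0,1]$ put $\xi=(1-\lambda)\bar m+\lambda\hat m-\frac1\kappa x_0$, $$\beta(\lambda)=\frac{-x_0\cdot\xi-\sqrt{(x_0\cdot\xi)^2-(1-\kappa^2)|\xi|^2}}{\kappa|\xi|^2},\qquad m(\lambda)=\tfrac1\kappa x_0+\beta(\lambda)\,\xi,$$ and $[\bar m,\hat m]_{x_0}=\{m(\lambda):0\le\lambda\le1\}$.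 *Structural hypotheses*, with constants $L>0$, $0\le\mu<\kappa$, $\mu_0>0$, $A>0$: * **H.A** (a) $\frac{X}{|X|}\cdot\frac{Y-X}{|Y-X|}\ge\kappa$ for all $X\in\Gamma$, $Y\in\Sigma$. (b) For each $X\in\Gamma$ there are a set $E(X)\subset\{m\in S^{n-1}: m\cdot \frac{X}{|X|}\ge\kappa\}$ and a continuous $s_X:E(X)\to(0,\infty)$ with $\Sigma=\{X+s_X(m)m:m\in E(X)\}$, and $[\bar m,\hat m]_{X/|X|}\subset E(X)$ for all $\bar m,\hat m\in E(X)$. (c) $|s_X(m_1)-s_X(m_2)|\le L|m_1-m_2|$ for all $X\in\Gamma$, $m_1,m_2\in E(X)$. * **H.B** $\frac{|X|}{|Y-X|}\le\kappa\left(\sqrt{1+(1+\kappa)^{-2}}-1\right)$ for all $X\in\Gamma$, $Y\in\Sigma$. * **H.C** For all $X_0\in\Gamma$, $\bar m,\hat m\in E(X_0)$, $\lambda\in[0,1]$, with $x_0=X_0/|X_0|$, $$\frac1{s_{X_0}(m(\lambda))}+\frac\mu{|X_0|}\ge(1-\lambda)\beta(\lambda)\left(\frac1{s_{X_0}(\bar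 m)}+\frac\mu{|X_0|}\right)+\lambda\beta(\lambda)\left(\frac1{s_{X_0}(\hat m)}+\frac\mu{|X_0|}\right).$$ * **H.D** For all $X_0\in\Gamma$, $\bar Y,\hat Y\in\Sigma$ and $0<t\le\mu_0$, $$H^{n-1}\left(N_t\left(\{Y(\lambda):\tfrac14\le\lambda\le\tfrac34\}\right)\cap\Sigma\right)\ge A\,t^{n-2}|\bar Y-\hat Y|,$$ where $Y(\lambda)=X_0+s_{X_0}(m(\lambda))m(\lambda)$ with $m(\lambda)$ formed from $x_0=\frac{X_0}{|X_0|}$, $\bar m=\frac{\bar Y-X_0}{|\bar Y-X_0|}$, $\hat m=\frac{\hat Y-X_0}{|\hat Y-X_0|}$; $N_t$ is the $t$-neighbourhood in $\mathbb R^n$ and $H^{n-1}$ the $(n-1)$-dimensional Hausdorff measure. *Refractors.* For $u:\Omega\to[c_1,c_2]$ and $x_0\in\Omega$ let $\partial u(x_0)$ be the set of $Y\in\Sigma$ with $u(x)\ge h(x,Y,u(x_0)x_0)$ for all $x\in\Omega$, and $\partial u(F)=\bigcup_{x\in F}\partial u(x)$. The function $u$ is a refractor from $\Omega$ to $\Sigma$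 if $\partial u(x_0)\ne\emptyset$ for every $x_0\in\Omega$. **Theorem.** Assume H.A–H.D, and let $R$ be such that $|Y|\le R$ for all $Y\in\Sigma$. Let $u$ be a refractor from $\Omega$ to $\Sigma$ and $M$ a constant with $$H^{n-1}\left(\partial u(B_\sigma\cap S^{n-1})\right)\le M\sigma^{n-1}$$ for every open ball $B_\sigma$ of radius $\sigma>0$ centred on $S^{n-1}$ with $B_\sigma\cap S^{n-1}\subseteq\Omega$. Let $\delta>0$ and let $B_\delta$, $B_{2\delta}$ be concentric open balls in $\mathbb R^n$ of radii $\delta$, $2\delta$ with $B_{2\delta}\cap S^{n-1}\subseteq\Omega$. Then there are positive constants $\tilde C_1,\tilde C_2$, depending only on $\delta$, $n$, $\kappa$, $c_1$, $c_2$, $L$, $\mu$, $\mu_0$, $A$, $R$ and $M$, such that if $\bar x,\hat x\in B_\delta\cap S^{n-1}$, $\bar Y\in\partial u(\bar x)$, $\hat Y\in\partial u(\hat x)$ and $|\bar Y-\hat Y|\ge\tilde C_1|\bar x-\hat x|$, then $$|\bar Y-\hat Y|\le\tilde C_2\,|\bar x-\hat x|^{\alpha},\qquad \alpha=\frac1{4n-5}.$$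 -/

import Mathlib

open scoped MeasureTheory

noncomputable section

namespace NearField

/-- Euclidean `n`-space. -/
abbrev V (n : ℕ) : Type := EuclideanSpace ℝ (Fin n)

/-- The unit sphere `S^{n-1}`. -/
def unitSphere (n : ℕ) : Set (V n) := Metric.sphere 0 1

/-- The direction `X / |X|`. -/
def dir {n : ℕ} (X : V n) : V n := ‖X‖⁻¹ • X

/-- `Ω` is a (relatively) open subset of the unit sphere. -/
def IsOpenInSphere {n : ℕ} (Ω : Set (V n)) : Prop :=
  ∃ U : Set (V n), IsOpen U ∧ Ω = U ∩ unitSphere n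

/-- The polar radius `ρ(x, Y, b)` of the Descartes oval `{X : |X| + κ |X - Y| = b}`. -/
def ovalRadius {n : ℕ} (κ : ℝ) (x Y : V n) (b : ℝ) : ℝ :=
  (b - κ ^ 2 * inner ℝ x Y -
      √((b - κ ^ 2 * inner ℝ x Y) ^ 2 - (1 - κ ^ 2) * (b ^ 2 - κ ^ 2 * ‖Y‖ ^ 2))) / (1 - κ ^ 2)

/-- `h(x, Y, X₀)`: the polar radius of the oval with focus `Y` passing through `X₀`. -/
def h {n : ℕ} (κ : ℝ) (x Y X₀ : V n) : ℝ :=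
  ovalRadius κ x Y (‖X₀‖ + κ * ‖X₀ - Y‖)

/-- `Γ = {r x : x ∈ Ω, c₁ ≤ r ≤ c₂}`. -/
def Gam {n : ℕ} (Ω : Set (V n)) (c₁ c₂ : ℝ) : Set (V n) :=
  {X | ∃ x ∈ Ω, ∃ r : ℝ, c₁ ≤ r ∧ r ≤ c₂ ∧ X = r • x}

/-- The cone `C_X` with vertex `X`, axis `X / |X|` and opening `arccos κ`. -/
def cone {n : ℕ} (κ : ℝ) (X : V n) : Set (V n) :=
  {Y | κ ≤ inner ℝ (dir X) (dir (Y - X))}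

/-- `ξ = m_λ - x₀ / κ`, with `m_λ = (1 - λ) m̄ + λ m̂`. -/
def chordDir {n : ℕ} (κ : ℝ) (x₀ mbar mhat : V n) (l : ℝ) : V n :=
  ((1 - l) • mbar + l • mhat) - κ⁻¹ • x₀

/-- The factor `β(λ)`. -/
def beta {n : ℕ} (κ : ℝ) (x₀ mbar mhat : V n) (l : ℝ) : ℝ :=
  (-(inner ℝ x₀ (chordDir κ x₀ mbar mhat l)) -
      √((inner ℝ x₀ (chordDir κ x₀ mbar mhat l)) ^ 2 -
        (1 - κ ^ 2) * ‖chordDir κ x₀ mbar mhat l‖ ^ 2)) /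
    (κ * ‖chordDir κ x₀ mbar mhat l‖ ^ 2)

/-- The point `m(λ)` of the curve `[m̄, m̂]_{x₀}`, the intersection of the unit sphere with the
triangle of vertices `m̄`, `m̂`, `x₀ / κ`. -/
def mCurve {n : ℕ} (κ : ℝ) (x₀ mbar mhat : V n) (l : ℝ) : V n :=
  κ⁻¹ • x₀ + beta κ x₀ mbar mhat l • chordDir κ x₀ mbar mhat l

/-- The curve `[m̄, m̂]_{x₀}`. -/
def mSegment {n : ℕ} (κ : ℝ) (x₀ mbar mhat : V n) : Set (V n) :=
  mCurve κ x₀ mbar mhat '' Set.Icc (0 : ℝ) 1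

/-- The point `Y(λ) = X₀ + s_{X₀}(m(λ)) m(λ)` of the curve `[Ȳ, Ŷ]_{X₀}`. -/
def yCurve {n : ℕ} (κ : ℝ) (s : V n → V n → ℝ) (X₀ Ybar Yhat : V n) (l : ℝ) : V n :=
  X₀ + s X₀ (mCurve κ (dir X₀) (dir (Ybar - X₀)) (dir (Yhat - X₀)) l) •
    mCurve κ (dir X₀) (dir (Ybar - X₀)) (dir (Yhat - X₀)) l

/-- Visibility of the target `S` from `Γ`: for each `X ∈ Γ` the target is the radial graph from `X`
of `s X` over the set of directions `E X`, with Lipschitz constant `L` independent of `X`. -/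
structure HypA {n : ℕ} (κ c₁ c₂ L : ℝ) (Ω S : Set (V n))
    (E : V n → Set (V n)) (s : V n → V n → ℝ) : Prop where
  subset_cone : S ⊆ ⋂ X ∈ Gam Ω c₁ c₂, cone κ X
  dir_mem : ∀ X ∈ Gam Ω c₁ c₂, ∀ m ∈ E X, m ∈ unitSphere n ∧ κ ≤ inner ℝ m (dir X)
  cont : ∀ X ∈ Gam Ω c₁ c₂, ContinuousOn (s X) (E X)
  pos : ∀ X ∈ Gam Ω c₁ c₂, ∀ m ∈ E X, 0 < s X m
  graph : ∀ X ∈ Gam Ω c₁ c₂, S = (fun m => X + s X m • m) '' E X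
  convex : ∀ X ∈ Gam Ω c₁ c₂, ∀ mbar ∈ E X, ∀ mhat ∈ E X, mSegment κ (dir X) mbar mhat ⊆ E X
  lipschitz : ∀ X ∈ Gam Ω c₁ c₂, ∀ m₁ ∈ E X, ∀ m₂ ∈ E X, |s X m₁ - s X m₂| ≤ L * ‖m₁ - m₂‖

/-- The target is far from `Γ`. -/
def HypB {n : ℕ} (κ c₁ c₂ : ℝ) (Ω S : Set (V n)) : Prop :=
  ∀ X ∈ Gam Ω c₁ c₂, ∀ Y ∈ S, ‖X‖ / ‖Y - X‖ ≤ κ * (√(1 + ((1 + κ) ^ 2)⁻¹) - 1)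

/-- The concavity condition on `1 / s_{X₀}`. -/
def HypC {n : ℕ} (κ c₁ c₂ μ : ℝ) (Ω : Set (V n))
    (E : V n → Set (V n)) (s : V n → V n → ℝ) : Prop :=
  ∀ X₀ ∈ Gam Ω c₁ c₂, ∀ mbar ∈ E X₀, ∀ mhat ∈ E X₀, ∀ l ∈ Set.Icc (0 : ℝ) 1,
    ((1 - l) * beta κ (dir X₀) mbar mhat l) * (1 / s X₀ mbar + μ / ‖X₀‖) +
        (l * beta κ (dir X₀) mbar mhat l) * (1 / s X₀ mhat + μ / ‖X₀‖)
      ≤ 1 / s X₀ (mCurve κ (dir X₀) mbar mhat l) + μ / ‖X₀‖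

/-- The lower bound on the `(n-1)`-dimensional Hausdorff measure of the part of the target in the
`t`-neighbourhood of the middle part of the curves `[Ȳ, Ŷ]_{X₀}`. -/
def HypD {n : ℕ} (κ c₁ c₂ μ₀ A : ℝ) (Ω S : Set (V n)) (s : V n → V n → ℝ) : Prop :=
  ∀ X₀ ∈ Gam Ω c₁ c₂, ∀ Ybar ∈ S, ∀ Yhat ∈ S, ∀ t : ℝ, 0 < t → t ≤ μ₀ →
    ENNReal.ofReal (A * t ^ (n - 2) * ‖Ybar - Yhat‖) ≤
      μH[(n : ℝ) - 1]
        (Metric.thickening t (yCurve κ s X₀ Ybar Yhat '' Set.Icc (1 / 4 : ℝ) (3 / 4)) ∩ S)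

/-- The subdifferential `∂u(x₀)`. -/
def subdiff {n : ℕ} (κ : ℝ) (Ω S : Set (V n)) (u : V n → ℝ) (x₀ : V n) : Set (V n) :=
  {Y | Y ∈ S ∧ ∀ x ∈ Ω, h κ x Y (u x₀ • x₀) ≤ u x}

/-- `u : Ω → [c₁, c₂]` is a refractor from `Ω` to `S`; only the values of `u` on `Ω` matter. -/
def IsRefractor {n : ℕ} (κ c₁ c₂ : ℝ) (Ω S : Set (V n)) (u : V n → ℝ) : Prop :=
  (∀ x ∈ Ω, u x ∈ Set.Icc c₁ c₂) ∧ ∀ x₀ ∈ Ω, (subdiff κ Ω S u x₀).Nonempty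

/-- `H^{n-1}(∂u(B_σ ∩ S^{n-1})) ≤ M σ^{n-1}` for all balls `B_σ`, centred on the sphere, with
`B_σ ∩ S^{n-1} ⊆ Ω`. -/
def MeasureBound {n : ℕ} (κ M : ℝ) (Ω S : Set (V n)) (u : V n → ℝ) : Prop :=
  ∀ z ∈ unitSphere n, ∀ σ : ℝ, 0 < σ → Metric.ball z σ ∩ unitSphere n ⊆ Ω →
    μH[(n : ℝ) - 1] (⋃ x ∈ Metric.ball z σ ∩ unitSphere n, subdiff κ Ω S u x) ≤
      ENNReal.ofReal (M * σ ^ (n - 1))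

end NearField

end

namespace NearField

/-! Write G_Y(X) = |X| + κ|X - Y|. By `mem_subdiff_iff`, Y ∈ ∂u(x₀) means that G_Y, restricted to
the graph of u, is minimal over x₀, so the proof works with G_Y and not with h. Put d = |Ȳ - Ŷ| and
let e bound |x̄ - x̂|.

Crossing (`exists_crossing`). Between x̄ and x̂ there is a direction x₀ at which G_Ȳ and G_Ŷ exceed
their minima by the same amount f. Tangent planes at X₀ = u(x₀)x₀ give f ≲ e² + d e, hence f ≲ d e
once e ≤ d (`crossing_bound`).

Growth (`growth_yCurve`). Squaring turns G_Y(X) ≥ G_Y(X₀) into an inequality affine in the direction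
m of Y from X₀ and in the inverse distance 1/s. The point m(λ) is an affine combination of m̄, m̂
and x₀/κ, the last with weight 1 - β ≳ d², and H.C is the matching inequality for 1/s. So for Y =
Y(λ) in the middle of the curve, G_Y(X) - G_Y(X₀) ≳ d²|x - x₀|² as soon as this dominates f, that is
for |x - x₀| ≥ σ with σ² ~ e/d.

Covering (`thickening_inter_subset`). Moving the focus by t changes the increment by O(t|x - x₀|).
With t ~ d²σ the growth survives, so every target point within t of the middle of the curve has its
minimum in the σ-cap about x₀ and lies in ∂u of that cap.

Measure (`pow_le_of_measure_bound`). H.D and the bound on ∂u give (d²σ)^(n-2) d ≲ σ^(n-1), so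
d^(2n-3) ≲ σ. Squaring and inserting σ² ~ e/d yields d^(4n-5) ≲ e. -/

/-! ### Supporting ovals and minimality of the optical path -/

/-- The function `|X| + κ |X - Y|`, whose level sets are the Descartes ovals with focus `Y`. -/
noncomputable def opticalPath {n : ℕ} (κ : ℝ) (Y X : V n) : ℝ := ‖X‖ + κ * ‖X - Y‖

/-- Squaring b - r = κ|rx - Y| gives a quadratic in r whose smaller root is h; its discriminant is
at least κ²(b - x·Y)² by Cauchy–Schwarz, which places h ≤ b ≤ larger root. For r ≥ b both sides
hold; for r < b, r is below the larger root, and h ≤ r says that the quadratic is nonpositive at r.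
-/
theorem h_le_iff {n : ℕ} {κ : ℝ} (hκ₀ : 0 < κ) (hκ₁ : κ < 1) {x Y X₀ : V n} (hx : ‖x‖ = 1)
    {r : ℝ} (hr : 0 ≤ r) :
    h κ x Y X₀ ≤ r ↔ opticalPath κ Y X₀ ≤ opticalPath κ Y (r • x) := by
  have hk : 0 < 1 - κ ^ 2 := by nlinarith
  have hG : opticalPath κ Y (r • x) = r + κ * ‖r • x - Y‖ := by
    simp [opticalPath, norm_smul, hx, abs_of_nonneg hr]
  rw [hG]
  unfold h ovalRadius
  change _ ↔ ‖X₀‖ + κ * ‖X₀ - Y‖ ≤ _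
  set b := ‖X₀‖ + κ * ‖X₀ - Y‖ with hb
  set p : ℝ := inner ℝ x Y with hp
  set N := ‖r • x - Y‖ with hN
  have hN0 : 0 ≤ N := norm_nonneg _
  have hNsq : N ^ 2 = r ^ 2 - 2 * (r * p) + ‖Y‖ ^ 2 := by
    rw [hN, norm_sub_sq_real, norm_smul, hx, inner_smul_left]
    simp [hp]
  have hpY : p ^ 2 ≤ ‖Y‖ ^ 2 := by
    have := abs_real_inner_le_norm x Y
    rw [hx, one_mul] at this
    exact sq_le_sq' (by linarith [neg_abs_le p]) (le_trans (le_abs_self p) this)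
  have hdisc : (κ * (b - p)) ^ 2 ≤
      (b - κ ^ 2 * p) ^ 2 - (1 - κ ^ 2) * (b ^ 2 - κ ^ 2 * ‖Y‖ ^ 2) := by
    have : 0 ≤ κ ^ 2 * (1 - κ ^ 2) * (‖Y‖ ^ 2 - p ^ 2) := by
      have := sub_nonneg.2 hpY
      positivity
    nlinarith
  set Δ := (b - κ ^ 2 * p) ^ 2 - (1 - κ ^ 2) * (b ^ 2 - κ ^ 2 * ‖Y‖ ^ 2) with hΔ
  have hΔ0 : 0 ≤ Δ := le_trans (sq_nonneg _) hdisc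
  have hsq : √Δ ^ 2 = Δ := Real.sq_sqrt hΔ0
  have hs0 : 0 ≤ √Δ := Real.sqrt_nonneg _
  have habs : |κ ^ 2 * (b - p)| ≤ √Δ := by
    apply Real.abs_le_sqrt
    refine le_trans ?_ hdisc
    have : 0 ≤ (1 - κ ^ 2) * (κ * (b - p)) ^ 2 := by positivity
    nlinarith
  rw [div_le_iff₀ hk]
  clear_value Δ b p N
  have key : (b - r) ^ 2 - κ ^ 2 * N ^ 2 =
      ((r * (1 - κ ^ 2) - (b - κ ^ 2 * p)) ^ 2 - √Δ ^ 2) / (1 - κ ^ 2) := by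
    rw [hsq, hΔ, hNsq]
    field_simp
    ring
  rcases le_or_gt b r with hbr | hbr
  · refine ⟨fun _ => by nlinarith, fun _ => ?_⟩
    have h1 := le_abs_self (κ ^ 2 * (b - p))
    have h2 := mul_le_mul_of_nonneg_right hbr hk.le
    linarith
  · have hlt : r * (1 - κ ^ 2) - (b - κ ^ 2 * p) < √Δ := by
      have h1 := neg_abs_le (κ ^ 2 * (b - p))
      have h2 := mul_lt_mul_of_pos_right hbr hk
      linarith
    constructor
    · intro hh
      have h1 : (r * (1 - κ ^ 2) - (b - κ ^ 2 * p)) ^ 2 - √Δ ^ 2 ≤ 0 := by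
        have := sq_le_sq' (a := r * (1 - κ ^ 2) - (b - κ ^ 2 * p)) (b := √Δ) (by linarith) hlt.le
        linarith
      have h2 : (b - r) ^ 2 - κ ^ 2 * N ^ 2 ≤ 0 := by
        rw [key]; exact div_nonpos_of_nonpos_of_nonneg h1 hk.le
      have := abs_le_of_sq_le_sq (a := b - r) (b := κ * N) (by nlinarith) (by positivity)
      linarith [le_abs_self (b - r)]
    · intro hh
      have h2 : (b - r) ^ 2 - κ ^ 2 * N ^ 2 ≤ 0 := by
        have : b - r ≤ κ * N := by linarith
        nlinarith
      rw [key, div_nonpos_iff] at h2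
      have h1 : (r * (1 - κ ^ 2) - (b - κ ^ 2 * p)) ^ 2 ≤ √Δ ^ 2 := by
        rcases h2 with h2 | h2 <;> linarith [h2.1, h2.2]
      have := abs_le_of_sq_le_sq h1 hs0
      linarith [neg_abs_le (r * (1 - κ ^ 2) - (b - κ ^ 2 * p))]

theorem IsOpenInSphere.norm_eq_one {n : ℕ} {Ω : Set (V n)} (hΩ : IsOpenInSphere Ω) {x : V n}
    (hx : x ∈ Ω) : ‖x‖ = 1 := by
  obtain ⟨U, -, rfl⟩ := hΩ
  simpa [unitSphere] using hx.2

/-- `Y ∈ ∂u(x₀)` if and only if the optical path to `Y` is minimal at `x₀` along the graph. -/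
theorem mem_subdiff_iff {n : ℕ} {κ c₁ c₂ : ℝ} (hκ₀ : 0 < κ) (hκ₁ : κ < 1) (hc₁ : 0 < c₁)
    {Ω S : Set (V n)} (hΩ : IsOpenInSphere Ω) {u : V n → ℝ}
    (hu : ∀ x ∈ Ω, u x ∈ Set.Icc c₁ c₂) {x₀ Y : V n} :
    Y ∈ subdiff κ Ω S u x₀ ↔
      Y ∈ S ∧ ∀ x ∈ Ω, opticalPath κ Y (u x₀ • x₀) ≤ opticalPath κ Y (u x • x) := by
  refine and_congr_right fun _ => forall₂_congr fun x hx => ?_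
  exact h_le_iff hκ₀ hκ₁ (hΩ.norm_eq_one hx) (hc₁.le.trans (hu x hx).1)

/-! ### Directions and expansions of the optical path -/

theorem norm_dir {n : ℕ} {X : V n} (hX : X ≠ 0) : ‖dir X‖ = 1 := by
  simp [dir, norm_smul, hX]

theorem norm_smul_dir {n : ℕ} (X : V n) : ‖X‖ • dir X = X := by
  rcases eq_or_ne X 0 with rfl | hX
  · simp [dir]
  · rw [dir, smul_smul, mul_inv_cancel₀ (norm_ne_zero_iff.2 hX), one_smul]

theorem dir_smul_of_norm_eq_one {n : ℕ} {x : V n} (hx : ‖x‖ = 1) {r : ℝ} (hr : 0 < r) :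
    dir (r • x) = x := by
  rw [dir, norm_smul, hx, mul_one, Real.norm_of_nonneg hr.le, smul_smul,
    inv_mul_cancel₀ hr.ne', one_smul]

theorem norm_mul_norm_dir_sub_dir_le {n : ℕ} (a b : V n) (hb : b ≠ 0) :
    ‖a‖ * ‖dir a - dir b‖ ≤ 2 * ‖a - b‖ := by
  have h1 : ‖a‖ • (dir a - dir b) = (a - b) + (‖b‖ - ‖a‖) • dir b := by
    rw [smul_sub, sub_smul, norm_smul_dir, norm_smul_dir]; abel
  have h2 : ‖a‖ * ‖dir a - dir b‖ = ‖‖a‖ • (dir a - dir b)‖ := by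
    rw [norm_smul, norm_norm]
  rw [h2, h1]
  refine (norm_add_le _ _).trans ?_
  rw [norm_smul, norm_dir hb, mul_one, Real.norm_eq_abs]
  have := abs_norm_sub_norm_le b a
  rw [norm_sub_rev b a] at this
  linarith

theorem norm_add_inner_dir_le {n : ℕ} (a v : V n) (ha : a ≠ 0) :
    ‖a‖ + inner ℝ (dir a) v ≤ ‖a + v‖ := by
  have h1 := real_inner_le_norm (dir a) (a + v)
  rw [norm_dir ha, one_mul, inner_add_right] at h1
  have h2 : inner ℝ (dir a) a = ‖a‖ := by
    nth_rewrite 2 [← norm_smul_dir a]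
    rw [inner_smul_right, real_inner_self_eq_norm_sq, norm_dir ha]; ring
  linarith

/-- The gap between the two sides is exactly (‖a + v‖ - ‖a‖)² / (2‖a‖). -/
theorem norm_add_le_inner_dir {n : ℕ} (a v : V n) (ha : a ≠ 0) :
    ‖a + v‖ ≤ ‖a‖ + inner ℝ (dir a) v + ‖v‖ ^ 2 / (2 * ‖a‖) := by
  have h0 : 0 < ‖a‖ := norm_pos_iff.2 ha
  have h1 : ‖a + v‖ ^ 2 = ‖a‖ ^ 2 + 2 * (‖a‖ * inner ℝ (dir a) v) + ‖v‖ ^ 2 := by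
    rw [norm_add_sq_real, ← real_inner_smul_left (dir a) v ‖a‖, norm_smul_dir]
  have h2 : ‖a‖ + inner ℝ (dir a) v + ‖v‖ ^ 2 / (2 * ‖a‖) - ‖a + v‖ =
      (‖a + v‖ - ‖a‖) ^ 2 / (2 * ‖a‖) := by
    field_simp
    linarith
  have : 0 ≤ (‖a + v‖ - ‖a‖) ^ 2 / (2 * ‖a‖) := by positivity
  linarith

/-- The gradient of the optical path at `X`. -/
noncomputable def pathGrad {n : ℕ} (κ : ℝ) (Y X : V n) : V n := dir X + κ • dir (X - Y)

theorem opticalPath_add_inner_le {n : ℕ} {κ : ℝ} (hκ₀ : 0 < κ) {X₀ X Y : V n} (hX₀ : X₀ ≠ 0)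
    (hY : X₀ - Y ≠ 0) :
    opticalPath κ Y X₀ + inner ℝ (pathGrad κ Y X₀) (X - X₀) ≤ opticalPath κ Y X := by
  have h1 := norm_add_inner_dir_le X₀ (X - X₀) hX₀
  have h2 := norm_add_inner_dir_le (X₀ - Y) (X - X₀) hY
  rw [add_sub_cancel] at h1
  rw [show X₀ - Y + (X - X₀) = X - Y by abel] at h2
  rw [opticalPath, opticalPath, pathGrad, inner_add_left, real_inner_smul_left]
  nlinarith

theorem opticalPath_le_add_inner {n : ℕ} {κ c : ℝ} (hκ₀ : 0 < κ) (hκ₁ : κ < 1) (hc : 0 < c)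
    {X₀ X Y : V n} (hX₀ : c ≤ ‖X₀‖) (hY : c ≤ ‖X₀ - Y‖) :
    opticalPath κ Y X ≤
      opticalPath κ Y X₀ + inner ℝ (pathGrad κ Y X₀) (X - X₀) + ‖X - X₀‖ ^ 2 / c := by
  have h1 := norm_add_le_inner_dir X₀ (X - X₀) (norm_pos_iff.1 (hc.trans_le hX₀))
  have h2 := norm_add_le_inner_dir (X₀ - Y) (X - X₀) (norm_pos_iff.1 (hc.trans_le hY))
  rw [add_sub_cancel] at h1
  rw [show X₀ - Y + (X - X₀) = X - Y by abel] at h2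
  have h3 : ‖X - X₀‖ ^ 2 / (2 * ‖X₀‖) ≤ ‖X - X₀‖ ^ 2 / (2 * c) := by gcongr
  have h4 : ‖X - X₀‖ ^ 2 / (2 * ‖X₀ - Y‖) ≤ ‖X - X₀‖ ^ 2 / (2 * c) := by gcongr
  have h5 : ‖X - X₀‖ ^ 2 / c = 2 * (‖X - X₀‖ ^ 2 / (2 * c)) := by field_simp
  have h6 : 0 ≤ ‖X - X₀‖ ^ 2 / (2 * c) := by positivity
  rw [opticalPath, opticalPath, pathGrad, inner_add_left, real_inner_smul_left]
  nlinarith [mul_le_mul_of_nonneg_left (h2.trans (add_le_add_right h4 _)) hκ₀.le]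

/-- Changing the focus by `t` changes increments of the optical path by `O(t |X - X₀|)`. -/
theorem opticalPath_sub_le {n : ℕ} {κ c t : ℝ} (hκ₀ : 0 < κ) (hκ₁ : κ < 1) (hc : 0 < c)
    {X₀ X Y Y' : V n} (hY : c ≤ ‖X₀ - Y‖) (ht : ‖Y - Y'‖ ≤ t) :
    opticalPath κ Y' X - opticalPath κ Y' X₀ - 4 * t * ‖X - X₀‖ / c ≤
      opticalPath κ Y X - opticalPath κ Y X₀ := by
  set v := X - X₀ with hv
  -- A difference of squares. The term ‖v‖² does not depend on Z, so it cancels between Y and Y'; no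
  -- lower bound on the distance from X to the foci is needed.
  have hid : ∀ Z : V n, (‖X - Z‖ - ‖X₀ - Z‖) * (‖X - Z‖ + ‖X₀ - Z‖) =
      ‖v‖ ^ 2 + 2 * inner ℝ v (X₀ - Z) := by
    intro Z
    have : X - Z = v + (X₀ - Z) := by rw [hv]; abel
    rw [this]
    have := norm_add_sq_real v (X₀ - Z)
    linarith
  have e1 := hid Y
  have e2 := hid Y'
  have hin : inner ℝ v (X₀ - Y) - inner ℝ v (X₀ - Y') = inner ℝ v (Y' - Y) := by
    rw [← inner_sub_right]; congr 1; abel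
  have hin' : |inner ℝ v (Y' - Y)| ≤ ‖v‖ * t := by
    refine (abs_real_inner_le_norm _ _).trans ?_
    rw [norm_sub_rev Y' Y]; gcongr
  have d1 : |‖X - Y'‖ - ‖X - Y‖| ≤ t := by
    refine (abs_norm_sub_norm_le _ _).trans ?_
    rwa [show X - Y' - (X - Y) = Y - Y' by abel]
  have d2 : |‖X₀ - Y'‖ - ‖X₀ - Y‖| ≤ t := by
    refine (abs_norm_sub_norm_le _ _).trans ?_
    rwa [show X₀ - Y' - (X₀ - Y) = Y - Y' by abel]
  have d3 : |‖X - Y'‖ - ‖X₀ - Y'‖| ≤ ‖v‖ := by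
    refine (abs_norm_sub_norm_le _ _).trans ?_
    rw [show X - Y' - (X₀ - Y') = v by rw [hv]; abel]
  have ht0 : 0 ≤ t := (norm_nonneg _).trans ht
  have hv0 := norm_nonneg v
  set P := ‖X - Y‖
  set P' := ‖X - Y'‖
  set Q := ‖X₀ - Y‖
  set Q' := ‖X₀ - Y'‖
  have hP : 0 ≤ P := norm_nonneg _
  have h1 : ((P' - Q') - (P - Q)) * (P + Q) =
      -(2 * inner ℝ v (Y' - Y)) - (P' - Q') * ((P' - P) + (Q' - Q)) := by
    linear_combination -e1 + e2 - 2 * hin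
  have h2 : |(P' - Q') * ((P' - P) + (Q' - Q))| ≤ ‖v‖ * (t + t) := by
    rw [abs_mul]
    exact mul_le_mul d3 ((abs_add_le _ _).trans (add_le_add d1 d2)) (abs_nonneg _) hv0
  have h3 : ((P' - Q') - (P - Q)) * (P + Q) ≤ 4 * t * ‖v‖ := by
    rw [h1]
    linarith [neg_abs_le (inner ℝ v (Y' - Y)),
      neg_abs_le ((P' - Q') * ((P' - P) + (Q' - Q)))]
  have h4 : (P' - Q') - (P - Q) ≤ 4 * t * ‖v‖ / c := by
    rw [le_div_iff₀ hc]
    rcases le_or_gt ((P' - Q') - (P - Q)) 0 with hneg | hpos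
    · exact (mul_nonpos_of_nonpos_of_nonneg hneg hc.le).trans (by positivity)
    · refine le_trans ?_ h3
      gcongr
      linarith
  have h5 : 0 ≤ 4 * t * ‖v‖ / c := by positivity
  simp only [opticalPath]
  nlinarith

/-! ### The factor β and the curve [m̄, m̂] -/

theorem inner_dir_self_right {n : ℕ} (X Z : V n) : ‖X‖ * inner ℝ Z (dir X) = inner ℝ Z X := by
  rw [← real_inner_smul_right Z (dir X) ‖X‖, norm_smul_dir]

theorem norm_convexComb_sq {n : ℕ} {a b : V n} (ha : ‖a‖ = 1) (hb : ‖b‖ = 1) (l : ℝ) :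
    ‖(1 - l) • a + l • b‖ ^ 2 = 1 - l * (1 - l) * ‖a - b‖ ^ 2 := by
  have h1 := norm_sub_sq_real a b
  rw [norm_add_sq_real, norm_smul, norm_smul, ha, hb, mul_one, mul_one, Real.norm_eq_abs,
    Real.norm_eq_abs, sq_abs, sq_abs, real_inner_smul_left, real_inner_smul_right]
  rw [ha, hb] at h1
  linear_combination l * (1 - l) * h1

section Beta

variable {n : ℕ} {κ : ℝ} {x₀ mbar mhat : V n} {l : ℝ}

theorem inner_chordDir_neg (hκ₀ : 0 < κ) (hκ₁ : κ < 1) (hx₀ : ‖x₀‖ = 1) (hbar : ‖mbar‖ = 1)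
    (hhat : ‖mhat‖ = 1) (hl : l ∈ Set.Icc (0 : ℝ) 1) :
    inner ℝ x₀ (chordDir κ x₀ mbar mhat l) < 0 := by
  have h1 := real_inner_le_norm x₀ mbar
  have h2 := real_inner_le_norm x₀ mhat
  rw [hx₀, hbar, one_mul] at h1
  rw [hx₀, hhat, one_mul] at h2
  have h3 : 1 < κ⁻¹ := (one_lt_inv₀ hκ₀).2 hκ₁
  rw [chordDir, inner_sub_right, inner_add_right, inner_smul_right, inner_smul_right,
    inner_smul_right, real_inner_self_eq_norm_sq, hx₀]
  nlinarith [mul_le_mul_of_nonneg_left h1 (sub_nonneg.2 hl.2), mul_le_mul_of_nonneg_left h2 hl.1]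

theorem beta_nonneg (hκ₀ : 0 < κ) (hκ₁ : κ < 1) (hx₀ : ‖x₀‖ = 1) (hbar : ‖mbar‖ = 1)
    (hhat : ‖mhat‖ = 1) (hl : l ∈ Set.Icc (0 : ℝ) 1) : 0 ≤ beta κ x₀ mbar mhat l := by
  have hp := inner_chordDir_neg hκ₀ hκ₁ hx₀ hbar hhat hl
  unfold beta
  refine div_nonneg ?_ (by positivity)
  rw [sub_nonneg, Real.sqrt_le_left (by linarith), neg_sq]
  have : 0 ≤ (1 - κ ^ 2) * ‖chordDir κ x₀ mbar mhat l‖ ^ 2 :=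
    mul_nonneg (by nlinarith) (by positivity)
  linarith

/-- β is the smaller root t of |x₀/κ + tξ|² = 1. At t = 1 the point is the convex combination of m̄
and m̂, which lies in the unit ball, so 1 is between the roots. -/
theorem beta_le_one (hκ₀ : 0 < κ) (hκ₁ : κ < 1) (hx₀ : ‖x₀‖ = 1) (hbar : ‖mbar‖ = 1)
    (hhat : ‖mhat‖ = 1) (hl : l ∈ Set.Icc (0 : ℝ) 1) : beta κ x₀ mbar mhat l ≤ 1 := by
  have hp := inner_chordDir_neg hκ₀ hκ₁ hx₀ hbar hhat hl
  have h1 : ‖κ⁻¹ • x₀ + chordDir κ x₀ mbar mhat l‖ ^ 2 ≤ 1 := by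
    rw [chordDir, add_sub_cancel, norm_convexComb_sq hbar hhat]
    have := mul_nonneg (mul_nonneg hl.1 (sub_nonneg.2 hl.2)) (sq_nonneg ‖mbar - mhat‖)
    linarith
  rw [norm_add_sq_real, norm_smul, hx₀, real_inner_smul_left, mul_one, Real.norm_of_nonneg
    (by positivity)] at h1
  unfold beta
  set ξ := chordDir κ x₀ mbar mhat l
  have hξ : 0 < ‖ξ‖ := by
    rw [norm_pos_iff]; intro h0; rw [h0, inner_zero_right] at hp; exact lt_irrefl _ hp
  set q : ℝ := inner ℝ x₀ ξ
  have h2 : 1 + 2 * κ * q + κ ^ 2 * ‖ξ‖ ^ 2 ≤ κ ^ 2 := by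
    have h3 := mul_le_mul_of_nonneg_left h1 (sq_nonneg κ)
    have h4 : κ ^ 2 * (κ⁻¹ ^ 2 + 2 * (κ⁻¹ * q) + ‖ξ‖ ^ 2) = 1 + 2 * κ * q + κ ^ 2 * ‖ξ‖ ^ 2 := by
      field_simp
    linarith
  rw [div_le_one (by positivity)]
  have h5 : |-q - κ * ‖ξ‖ ^ 2| ≤ √(q ^ 2 - (1 - κ ^ 2) * ‖ξ‖ ^ 2) := by
    apply Real.abs_le_sqrt
    nlinarith [mul_le_mul_of_nonneg_right h2 (sq_nonneg ‖ξ‖)]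
  linarith [le_abs_self (-q - κ * ‖ξ‖ ^ 2)]

/-- Strict convexity of the ball: since λ(1 - λ) ≥ 3/16, the chord point lies at depth at least
(3/32)|m̄ - m̂|² below the sphere. The displacement to m(λ) has length (1 - β)|ξ| with |ξ| ≤ 2/κ,
and must cover that depth. -/
theorem mul_norm_sub_sq_le_one_sub_beta (hκ₀ : 0 < κ) (hκ₁ : κ < 1) (hx₀ : ‖x₀‖ = 1)
    (hbar : ‖mbar‖ = 1) (hhat : ‖mhat‖ = 1) (hl : l ∈ Set.Icc (1 / 4 : ℝ) (3 / 4))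
    (hm : ‖mCurve κ x₀ mbar mhat l‖ = 1) :
    3 * κ / 64 * ‖mbar - mhat‖ ^ 2 ≤ 1 - beta κ x₀ mbar mhat l := by
  have hl' : l ∈ Set.Icc (0 : ℝ) 1 := ⟨by linarith [hl.1], by linarith [hl.2]⟩
  have hβ := beta_le_one hκ₀ hκ₁ hx₀ hbar hhat hl'
  have hsq := norm_convexComb_sq hbar hhat l
  set β := beta κ x₀ mbar mhat l with hβd
  set ml := (1 - l) • mbar + l • mhat with hml
  have hξ : chordDir κ x₀ mbar mhat l = ml - κ⁻¹ • x₀ := rfl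
  have h1 : mCurve κ x₀ mbar mhat l = ml - (1 - β) • (ml - κ⁻¹ • x₀) := by
    rw [mCurve, hξ, ← hβd]; module
  have hq : 3 / 16 ≤ l * (1 - l) := by nlinarith [hl.1, hl.2]
  have hml1 : ‖ml‖ ^ 2 ≤ 1 - 3 / 16 * ‖mbar - mhat‖ ^ 2 := by
    rw [hsq]; nlinarith [mul_le_mul_of_nonneg_right hq (sq_nonneg ‖mbar - mhat‖)]
  have hml0 := norm_nonneg ml
  have hml2 : ‖ml‖ ≤ 1 := by
    rw [← sq_le_one_iff₀ hml0]; nlinarith [sq_nonneg ‖mbar - mhat‖]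
  have hκi : 1 ≤ κ⁻¹ := ((one_lt_inv₀ hκ₀).2 hκ₁).le
  have hξ2 : ‖ml - κ⁻¹ • x₀‖ ≤ 2 * κ⁻¹ := by
    refine (norm_sub_le _ _).trans ?_
    rw [norm_smul, hx₀, mul_one, Real.norm_of_nonneg (by positivity)]
    linarith
  have h2 : 1 ≤ ‖ml‖ + (1 - β) * (2 * κ⁻¹) := by
    have h3 := norm_sub_le ml ((1 - β) • (ml - κ⁻¹ • x₀))
    rw [← h1, hm, norm_smul, Real.norm_of_nonneg (sub_nonneg.2 hβ)] at h3
    have := mul_le_mul_of_nonneg_left hξ2 (sub_nonneg.2 hβ)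
    linarith
  have h3 : 3 / 32 * ‖mbar - mhat‖ ^ 2 ≤ (1 - β) * (2 * κ⁻¹) := by nlinarith
  have h4 := mul_le_mul_of_nonneg_right h3 hκ₀.le
  have h5 : (1 - β) * (2 * κ⁻¹) * κ = 2 * (1 - β) := by field_simp
  linarith

end Beta

/-! ### Concavity of the squared optical path inequality -/

/-- The defect in the squared optical path inequality, an affine function of `(m, σ)`, where `m` is the
direction and `σ` the inverse distance of the focus as seen from `X₀`. -/
noncomputable def pathDefect {n : ℕ} (κ : ℝ) (X₀ X m : V n) (σ : ℝ) : ℝ :=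
  (κ ^ 2 * ‖X - X₀‖ ^ 2 - (‖X₀‖ - ‖X‖) ^ 2) / (2 * κ) * σ - (‖X₀‖ - ‖X‖) -
    κ * inner ℝ (X - X₀) m

/-- Both sides are (κ|X - Y|)² - (κs + |X₀| - |X|)² with Y = X₀ + sm, and s = |X₀ - Y|. -/
theorem pathDefect_mul_eq {n : ℕ} {κ s : ℝ} (hκ₀ : 0 < κ) (hs : 0 < s) {X₀ X m : V n}
    (hm : ‖m‖ = 1) :
    2 * κ * s * pathDefect κ X₀ X m (1 / s) =
      (opticalPath κ (X₀ + s • m) X - opticalPath κ (X₀ + s • m) X₀) *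
        (κ * ‖X - (X₀ + s • m)‖ + (‖X₀‖ - ‖X‖) + κ * s) := by
  have h1 : ‖X₀ - (X₀ + s • m)‖ = s := by
    rw [sub_add_cancel_left, norm_neg, norm_smul, hm, mul_one, Real.norm_of_nonneg hs.le]
  have h2 : ‖X - (X₀ + s • m)‖ ^ 2 = ‖X - X₀‖ ^ 2 - 2 * (s * inner ℝ (X - X₀) m) + s ^ 2 := by
    rw [show X - (X₀ + s • m) = (X - X₀) - s • m by abel, norm_sub_sq_real,
      real_inner_smul_right, norm_smul, hm, mul_one, Real.norm_of_nonneg hs.le]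
  rw [opticalPath, opticalPath, h1, pathDefect]
  field_simp
  linear_combination -κ ^ 2 * h2

/-- Points whose norms differ by at most `κ` times their distance: the factor relating
`pathDefect` and the optical path is controlled. -/
theorem pathFactor_bounds {n : ℕ} {κ s : ℝ} (hκ₀ : 0 < κ) (hs : 0 < s) {X₀ X m : V n}
    (hm : ‖m‖ = 1) (ha : |‖X₀‖ - ‖X‖| ≤ κ * ‖X - X₀‖) :
    0 ≤ κ * ‖X - (X₀ + s • m)‖ + (‖X₀‖ - ‖X‖) + κ * s ∧
      κ * ‖X - (X₀ + s • m)‖ + (‖X₀‖ - ‖X‖) + κ * s ≤ 2 * κ * (s + ‖X - X₀‖) := by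
  have hsm : ‖s • m‖ = s := by rw [norm_smul, hm, mul_one, Real.norm_of_nonneg hs.le]
  have e : X - (X₀ + s • m) = (X - X₀) - s • m := by abel
  have h1 : ‖X - X₀‖ ≤ ‖X - (X₀ + s • m)‖ + s := by
    have := norm_add_le (X - (X₀ + s • m)) (s • m)
    rwa [e, sub_add_cancel, hsm, ← e] at this
  have h2 : ‖X - (X₀ + s • m)‖ ≤ ‖X - X₀‖ + s := by
    rw [e]; exact (norm_sub_le _ _).trans_eq (by rw [hsm])
  have h3 := neg_abs_le (‖X₀‖ - ‖X‖)
  have h4 := le_abs_self (‖X₀‖ - ‖X‖)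
  constructor
  · nlinarith [mul_le_mul_of_nonneg_left h1 hκ₀.le]
  · nlinarith [mul_le_mul_of_nonneg_left h2 hκ₀.le]

/-- After division of `pathDefect_mul_eq` by 2κs, the multiplier of the increment lies in [0, 1 +
D/c]. Hence a lower bound -f passes to the defect with this loss; `le_mul_opticalPath_sub` goes back
from a positive defect to the increment. -/
theorem neg_mul_le_pathDefect {n : ℕ} {κ s c D f : ℝ} (hκ₀ : 0 < κ) (hc : 0 < c) (hs : c ≤ s)
    (hf : 0 ≤ f) {X₀ X m : V n} (hm : ‖m‖ = 1) (ha : |‖X₀‖ - ‖X‖| ≤ κ * ‖X - X₀‖)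
    (hD : ‖X - X₀‖ ≤ D)
    (h : -f ≤ opticalPath κ (X₀ + s • m) X - opticalPath κ (X₀ + s • m) X₀) :
    -((1 + D / c) * f) ≤ pathDefect κ X₀ X m (1 / s) := by
  have hs0 : 0 < s := hc.trans_le hs
  obtain ⟨p0, p1⟩ := pathFactor_bounds hκ₀ hs0 hm ha
  have hid := pathDefect_mul_eq (X := X) hκ₀ hs0 hm (X₀ := X₀)
  set P := κ * ‖X - (X₀ + s • m)‖ + (‖X₀‖ - ‖X‖) + κ * s
  set F := pathDefect κ X₀ X m (1 / s)
  have hD0 : 0 ≤ D := (norm_nonneg _).trans hD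
  have h1 : -f * P ≤ 2 * κ * s * F := by rw [hid]; exact mul_le_mul_of_nonneg_right h p0
  have h2 : s + ‖X - X₀‖ ≤ s * (1 + D / c) := by
    have : D ≤ s * (D / c) := by
      rw [mul_div_assoc', le_div_iff₀ hc, mul_comm]; gcongr
    linarith
  have h3 : f * P ≤ f * (2 * κ * (s * (1 + D / c))) := by
    refine mul_le_mul_of_nonneg_left (p1.trans ?_) hf
    gcongr
  have h4 : 2 * κ * s * (-((1 + D / c) * f)) ≤ 2 * κ * s * F := by nlinarith
  exact le_of_mul_le_mul_left h4 (by positivity)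

theorem le_mul_opticalPath_sub {n : ℕ} {κ s c D : ℝ} (hκ₀ : 0 < κ) (hc : 0 < c) (hs : c ≤ s)
    {X₀ X m : V n} (hm : ‖m‖ = 1) (ha : |‖X₀‖ - ‖X‖| ≤ κ * ‖X - X₀‖) (hD : ‖X - X₀‖ ≤ D)
    (hF : 0 < pathDefect κ X₀ X m (1 / s)) :
    pathDefect κ X₀ X m (1 / s) ≤
      (1 + D / c) * (opticalPath κ (X₀ + s • m) X - opticalPath κ (X₀ + s • m) X₀) := by
  have hs0 : 0 < s := hc.trans_le hs
  obtain ⟨p0, p1⟩ := pathFactor_bounds hκ₀ hs0 hm ha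
  have hid := pathDefect_mul_eq (X := X) hκ₀ hs0 hm (X₀ := X₀)
  set P := κ * ‖X - (X₀ + s • m)‖ + (‖X₀‖ - ‖X‖) + κ * s
  set F := pathDefect κ X₀ X m (1 / s)
  set G := opticalPath κ (X₀ + s • m) X - opticalPath κ (X₀ + s • m) X₀
  have hG : 0 < G := by
    have : 0 < G * P := by rw [← hid]; positivity
    exact pos_of_mul_pos_left this p0
  have hD0 : 0 ≤ D := (norm_nonneg _).trans hD
  have h2 : s + ‖X - X₀‖ ≤ s * (1 + D / c) := by
    have : D ≤ s * (D / c) := by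
      rw [mul_div_assoc', le_div_iff₀ hc, mul_comm]; gcongr
    linarith
  have h3 : G * P ≤ G * (2 * κ * (s * (1 + D / c))) := by
    refine mul_le_mul_of_nonneg_left (p1.trans ?_) hG.le
    gcongr
  have h4 : 2 * κ * s * F ≤ 2 * κ * s * ((1 + D / c) * G) := by nlinarith
  exact le_of_mul_le_mul_left h4 (by positivity)

/-- The concavity condition on `1 / s` makes `pathDefect` quantitatively concave along the curve
`[m̄, m̂]`. -/
theorem pathDefect_mCurve_ge {n : ℕ} {κ μ : ℝ} (hκ₀ : 0 < κ) (hκ₁ : κ < 1) (hμ : 0 ≤ μ)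
    {X₀ X mbar mhat : V n} (hX₀ : X₀ ≠ 0) {l σbar σhat σ : ℝ}
    (hβ : beta κ (dir X₀) mbar mhat l ≤ 1) (ha : |‖X₀‖ - ‖X‖| ≤ κ * ‖X - X₀‖)
    (hC : ((1 - l) * beta κ (dir X₀) mbar mhat l) * (σbar + μ / ‖X₀‖) +
        (l * beta κ (dir X₀) mbar mhat l) * (σhat + μ / ‖X₀‖) ≤ σ + μ / ‖X₀‖) :
    beta κ (dir X₀) mbar mhat l *
        ((1 - l) * pathDefect κ X₀ X mbar σbar + l * pathDefect κ X₀ X mhat σhat) +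
      (1 - beta κ (dir X₀) mbar mhat l) * ((1 - μ * κ) * (‖X‖ - inner ℝ X (dir X₀))) ≤
      pathDefect κ X₀ X (mCurve κ (dir X₀) mbar mhat l) σ := by
  have hX₀' : 0 < ‖X₀‖ := norm_pos_iff.2 hX₀
  have hx₀ := norm_dir hX₀
  have hw : ‖X - X₀‖ ^ 2 = (‖X₀‖ - ‖X‖) ^ 2 + 2 * ‖X₀‖ * (‖X‖ - inner ℝ X (dir X₀)) := by
    rw [norm_sub_sq_real]
    linear_combination 2 * inner_dir_self_right X₀ X
  have hv : inner ℝ (X - X₀) (dir X₀) = inner ℝ X (dir X₀) - ‖X₀‖ := by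
    rw [inner_sub_left]
    have := inner_dir_self_right X₀ X₀
    rw [real_inner_self_eq_norm_sq] at this
    have : inner ℝ X₀ (dir X₀) = ‖X₀‖ := mul_left_cancel₀ hX₀'.ne' (by linarith)
    rw [this]
  simp only [pathDefect, mCurve, chordDir, inner_add_right, inner_sub_right, inner_smul_right, hv]
  set β := beta κ (dir X₀) mbar mhat l
  set w := inner ℝ X (dir X₀)
  -- H.C reads σ ≥ β((1-λ)σ̄ + λσ̂) + (1-β)(-μ/|X₀|), with the same weights as m(λ) = β((1-λ)m̄ +
  -- λm̂) + (1-β)x₀/κ. As Q ≥ 0, the affine defect at m(λ) is at least the combination of its values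
  -- at the three vertices. At x₀/κ, with value -μ/|X₀| for σ, it equals |X| - X·x₀ - Qμ/|X₀|, and
  -- `hQ2` bounds the last term by μκ(|X| - X·x₀).
  set Q := (κ ^ 2 * ‖X - X₀‖ ^ 2 - (‖X₀‖ - ‖X‖) ^ 2) / (2 * κ) with hQ
  have hQ0 : 0 ≤ Q := by
    refine div_nonneg ?_ (by positivity)
    have := sq_le_sq' (a := ‖X₀‖ - ‖X‖) (b := κ * ‖X - X₀‖)
      (by linarith [neg_abs_le (‖X₀‖ - ‖X‖)]) (by linarith [le_abs_self (‖X₀‖ - ‖X‖)])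
    nlinarith
  have hQ1 : Q ≤ κ * ‖X₀‖ * (‖X‖ - w) := by
    rw [hQ, hw, div_le_iff₀ (by positivity)]
    nlinarith [mul_nonneg (show 0 ≤ 1 - κ ^ 2 by nlinarith) (sq_nonneg (‖X₀‖ - ‖X‖))]
  have hQ2 : Q * (μ / ‖X₀‖) ≤ μ * κ * (‖X‖ - w) := by
    rw [mul_div_assoc', div_le_iff₀ hX₀']
    nlinarith [mul_le_mul_of_nonneg_right hQ1 hμ]
  have hC' := mul_le_mul_of_nonneg_left hC hQ0
  have hκ : κ * (κ⁻¹ * (w - ‖X₀‖)) = w - ‖X₀‖ := by field_simp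
  nlinarith [mul_le_mul_of_nonneg_left hQ2 (sub_nonneg.2 hβ)]

/-! ### Lipschitz graph of a refractor and distance to the target -/

section Refractor

variable {n : ℕ} {κ c₁ c₂ : ℝ} {Ω S : Set (V n)} {u : V n → ℝ}

theorem norm_graph (hc₁ : 0 < c₁) (hΩ : IsOpenInSphere Ω) (hu : IsRefractor κ c₁ c₂ Ω S u)
    {x : V n} (hx : x ∈ Ω) : ‖u x • x‖ = u x := by
  rw [norm_smul, hΩ.norm_eq_one hx, mul_one,
    Real.norm_of_nonneg (hc₁.le.trans (hu.1 x hx).1)]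

theorem graph_mem_Gam (hu : IsRefractor κ c₁ c₂ Ω S u) {x : V n} (hx : x ∈ Ω) :
    u x • x ∈ Gam Ω c₁ c₂ :=
  ⟨x, hx, u x, (hu.1 x hx).1, (hu.1 x hx).2, rfl⟩

/-- Minimality of G_Y at one of the points gives |X₀| - |X| ≤ κ(|X - Y| - |X₀ - Y|), and the
triangle inequality removes Y. As κ < 1, this makes u Lipschitz, and it is the condition needed in
`pathFactor_bounds`. -/
theorem abs_norm_sub_norm_graph_le (hκ₀ : 0 < κ) (hκ₁ : κ < 1) (hc₁ : 0 < c₁)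
    (hΩ : IsOpenInSphere Ω) (hu : IsRefractor κ c₁ c₂ Ω S u) {x x₀ : V n} (hx : x ∈ Ω)
    (hx₀ : x₀ ∈ Ω) :
    |‖u x₀ • x₀‖ - ‖u x • x‖| ≤ κ * ‖u x • x - u x₀ • x₀‖ := by
  have key : ∀ a ∈ Ω, ∀ b ∈ Ω, ‖u a • a‖ - ‖u b • b‖ ≤ κ * ‖u b • b - u a • a‖ := by
    intro a ha b hb
    obtain ⟨Y, hY⟩ := hu.2 a ha
    have h1 := ((mem_subdiff_iff hκ₀ hκ₁ hc₁ hΩ hu.1).1 hY).2 b hb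
    have h2 := norm_sub_norm_le (u b • b - Y) (u a • a - Y)
    rw [sub_sub_sub_cancel_right] at h2
    simp only [opticalPath] at h1
    nlinarith [mul_le_mul_of_nonneg_left h2 hκ₀.le]
  rw [abs_le]
  constructor
  · have := key x hx x₀ hx₀
    rw [norm_sub_rev] at this
    linarith
  · exact key x₀ hx₀ x hx

theorem norm_graph_sub_le (hκ₀ : 0 < κ) (hκ₁ : κ < 1) (hc₁ : 0 < c₁)
    (hΩ : IsOpenInSphere Ω) (hu : IsRefractor κ c₁ c₂ Ω S u) {x x₀ : V n} (hx : x ∈ Ω)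
    (hx₀ : x₀ ∈ Ω) :
    ‖u x • x - u x₀ • x₀‖ ≤ c₂ / (1 - κ) * ‖x - x₀‖ := by
  have h1 := abs_norm_sub_norm_graph_le hκ₀ hκ₁ hc₁ hΩ hu hx hx₀
  rw [norm_graph hc₁ hΩ hu hx, norm_graph hc₁ hΩ hu hx₀, abs_sub_comm] at h1
  have h2 : u x • x - u x₀ • x₀ = (u x - u x₀) • x + u x₀ • (x - x₀) := by module
  have h3 := norm_add_le ((u x - u x₀) • x) (u x₀ • (x - x₀))
  rw [← h2, norm_smul, norm_smul, hΩ.norm_eq_one hx, mul_one, Real.norm_eq_abs,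
    Real.norm_of_nonneg (hc₁.le.trans (hu.1 x₀ hx₀).1)] at h3
  have h4 := mul_le_mul_of_nonneg_right (hu.1 x₀ hx₀).2 (norm_nonneg (x - x₀))
  rw [div_mul_eq_mul_div, le_div_iff₀ (by linarith)]
  linarith

theorem continuousOn_graph (hκ₀ : 0 < κ) (hκ₁ : κ < 1) (hc₁ : 0 < c₁) (hc₂ : c₁ < c₂)
    (hΩ : IsOpenInSphere Ω) (hu : IsRefractor κ c₁ c₂ Ω S u) :
    ContinuousOn (fun x => u x • x) Ω := by
  have hK : 0 ≤ c₂ / (1 - κ) := div_nonneg (by linarith) (by linarith)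
  refine (LipschitzOnWith.of_dist_le_mul (K := ⟨c₂ / (1 - κ), hK⟩) ?_).continuousOn
  intro x hx y hy
  rw [dist_eq_norm, dist_eq_norm]
  exact norm_graph_sub_le hκ₀ hκ₁ hc₁ hΩ hu hx hy

end Refractor

theorem continuous_opticalPath {n : ℕ} (κ : ℝ) (Y : V n) : Continuous (opticalPath κ Y) := by
  unfold opticalPath
  fun_prop

section Target

variable {n : ℕ} {κ c₁ c₂ L : ℝ} {Ω S : Set (V n)} {E : V n → Set (V n)} {s : V n → V n → ℝ}

theorem norm_mem_of_mem_Gam (hc₁ : 0 < c₁) (hΩ : IsOpenInSphere Ω) {X : V n}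
    (hX : X ∈ Gam Ω c₁ c₂) : c₁ ≤ ‖X‖ ∧ ‖X‖ ≤ c₂ := by
  obtain ⟨x, hx, r, h1, h2, rfl⟩ := hX
  rw [norm_smul, hΩ.norm_eq_one hx, mul_one, Real.norm_of_nonneg (hc₁.le.trans h1)]
  exact ⟨h1, h2⟩

theorem HypA.exists_dir (hA : HypA κ c₁ c₂ L Ω S E s) {X Y : V n} (hX : X ∈ Gam Ω c₁ c₂)
    (hY : Y ∈ S) : dir (Y - X) ∈ E X ∧ s X (dir (Y - X)) = ‖Y - X‖ := by
  rw [hA.graph X hX] at hY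
  obtain ⟨m, hm, rfl⟩ := hY
  have h1 : ‖m‖ = 1 := by simpa [unitSphere] using (hA.dir_mem X hX m hm).1
  have h2 := hA.pos X hX m hm
  simp only [add_sub_cancel_left]
  rw [dir_smul_of_norm_eq_one h1 h2, norm_smul, h1, mul_one, Real.norm_of_nonneg h2.le]
  exact ⟨hm, rfl⟩

theorem HypB.le_norm_sub (hκ₀ : 0 < κ) (hκ₁ : κ < 1) (hA : HypA κ c₁ c₂ L Ω S E s)
    (hB : HypB κ c₁ c₂ Ω S) {X Y : V n} (hX : X ∈ Gam Ω c₁ c₂) (hY : Y ∈ S) :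
    ‖X‖ ≤ ‖Y - X‖ := by
  have h1 := hB X hX Y hY
  obtain ⟨h2, h3⟩ := hA.exists_dir hX hY
  have h4 := hA.pos X hX _ h2
  rw [h3] at h4
  rw [div_le_iff₀ h4] at h1
  have h5 : √(1 + ((1 + κ) ^ 2)⁻¹) ≤ 2 := by
    rw [Real.sqrt_le_left (by norm_num)]
    have : ((1 + κ) ^ 2)⁻¹ ≤ 1 := inv_le_one_of_one_le₀ (by nlinarith)
    linarith
  have h6 : κ * (√(1 + ((1 + κ) ^ 2)⁻¹) - 1) ≤ 1 := by nlinarith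
  nlinarith

end Target

/-! ### The crossing point -/

/-- The common defect of two supporting ovals at their crossing direction is controlled by their
tangent planes. -/
theorem crossing_bound {n : ℕ} {κ c W f η t₁ t₂ : ℝ} (hκ₀ : 0 < κ) (hκ₁ : κ < 1) (hc : 0 < c)
    {X₀ Xbar Xhat Y₀ Ybar Yhat : V n} (hX₀ : c ≤ ‖X₀‖) (hY₀ : c ≤ ‖X₀ - Y₀‖)
    (hYbar : c ≤ ‖X₀ - Ybar‖) (hYhat : c ≤ ‖X₀ - Yhat‖) (hWbar : ‖Xbar - X₀‖ ≤ W)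
    (hWhat : ‖Xhat - X₀‖ ≤ W) (ht₁ : 0 ≤ t₁) (ht₂ : 0 ≤ t₂) (ht : t₁ + t₂ = 1)
    (hη : t₁ • (Xbar - X₀) + t₂ • (Xhat - X₀) = η • dir X₀)
    (h₀bar : opticalPath κ Y₀ X₀ ≤ opticalPath κ Y₀ Xbar)
    (h₀hat : opticalPath κ Y₀ X₀ ≤ opticalPath κ Y₀ Xhat)
    (hfbar : f = opticalPath κ Ybar X₀ - opticalPath κ Ybar Xbar)
    (hfhat : f = opticalPath κ Yhat X₀ - opticalPath κ Yhat Xhat) :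
    f ≤ 2 * W ^ 2 / (c * (1 - κ)) + 2 * W * ‖Ybar - Yhat‖ / c := by
  have hX₀' : X₀ ≠ 0 := norm_pos_iff.1 (hc.trans_le hX₀)
  have hne : ∀ Y : V n, c ≤ ‖X₀ - Y‖ → X₀ - Y ≠ 0 := fun Y hY =>
    norm_pos_iff.1 (hc.trans_le hY)
  have hx₀ := norm_dir hX₀'
  have hW : 0 ≤ W := (norm_nonneg _).trans hWbar
  have hgx : ∀ Y : V n, c ≤ ‖X₀ - Y‖ →
      1 - κ ≤ inner ℝ (pathGrad κ Y X₀) (dir X₀) ∧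
        inner ℝ (pathGrad κ Y X₀) (dir X₀) ≤ 2 := by
    intro Y hY
    have h1 := abs_real_inner_le_norm (dir (X₀ - Y)) (dir X₀)
    rw [hx₀, norm_dir (hne Y hY), one_mul, abs_le] at h1
    rw [pathGrad, inner_add_left, real_inner_smul_left, real_inner_self_eq_norm_sq, hx₀]
    constructor <;> nlinarith [h1.1, h1.2]
  have hin : ∀ g : V n, t₁ * inner ℝ g (Xbar - X₀) + t₂ * inner ℝ g (Xhat - X₀) =
      η * inner ℝ g (dir X₀) := by
    intro g
    rw [← real_inner_smul_right, ← real_inner_smul_right, ← real_inner_smul_right,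
      ← inner_add_right, hη]
  have hκ' : 0 < 1 - κ := by linarith
  -- Y₀ supports at X₀, so the slopes of G_{Y₀} towards both contact points are at least -W²/c.
  -- Their weighted mean is η times the radial slope, which is at least 1 - κ: the radial
  -- displacement cannot be very negative.
  have hη' : -(W ^ 2 / (c * (1 - κ))) ≤ η := by
    have h1 := opticalPath_le_add_inner (X := Xbar) hκ₀ hκ₁ hc hX₀ hY₀
    have h2 := opticalPath_le_add_inner (X := Xhat) hκ₀ hκ₁ hc hX₀ hY₀
    have h3 : ‖Xbar - X₀‖ ^ 2 / c ≤ W ^ 2 / c := by gcongr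
    have h4 : ‖Xhat - X₀‖ ^ 2 / c ≤ W ^ 2 / c := by gcongr
    have h5 : -(W ^ 2 / c) ≤ inner ℝ (pathGrad κ Y₀ X₀) (Xbar - X₀) := by linarith
    have h6 : -(W ^ 2 / c) ≤ inner ℝ (pathGrad κ Y₀ X₀) (Xhat - X₀) := by linarith
    have h7 : -(W ^ 2 / c) ≤ η * inner ℝ (pathGrad κ Y₀ X₀) (dir X₀) := by
      rw [← hin]
      have h8 := mul_le_mul_of_nonneg_left h5 ht₁
      have h9 := mul_le_mul_of_nonneg_left h6 ht₂
      have : -(W ^ 2 / c) = t₁ * -(W ^ 2 / c) + t₂ * -(W ^ 2 / c) := by rw [← add_mul, ht, one_mul]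
      linarith
    have h8 := hgx Y₀ hY₀
    have h9 : W ^ 2 / (c * (1 - κ)) = W ^ 2 / c / (1 - κ) := by rw [div_div]
    rcases le_or_gt 0 η with hη0 | hη0
    · exact le_trans (by rw [neg_nonpos]; positivity) hη0
    · rw [h9, ← neg_div, div_le_iff₀ hκ']
      nlinarith [h8.1]
  have hgr : ‖pathGrad κ Ybar X₀ - pathGrad κ Yhat X₀‖ ≤ 2 * ‖Ybar - Yhat‖ / c := by
    have h1 : pathGrad κ Ybar X₀ - pathGrad κ Yhat X₀ =
        κ • (dir (X₀ - Ybar) - dir (X₀ - Yhat)) := by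
      simp only [pathGrad]; module
    have h2 := norm_mul_norm_dir_sub_dir_le (X₀ - Ybar) (X₀ - Yhat) (hne Yhat hYhat)
    rw [sub_sub_sub_cancel_left, norm_sub_rev Yhat Ybar] at h2
    rw [h1, norm_smul, Real.norm_of_nonneg hκ₀.le, le_div_iff₀ hc]
    have h3 := norm_nonneg (dir (X₀ - Ybar) - dir (X₀ - Yhat))
    nlinarith [mul_le_mul_of_nonneg_right hYbar h3, mul_nonneg h3 hc.le]
  have h1 := opticalPath_add_inner_le (X := Xbar) hκ₀ hX₀' (hne Ybar hYbar)
  have h2 := opticalPath_add_inner_le (X := Xhat) hκ₀ hX₀' (hne Yhat hYhat)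
  -- By convexity f is at most minus the slope of either path towards its own contact point.
  -- Averaging with t₁, t₂ and replacing the gradient for Ŷ by that for Ȳ leaves -η times a radial
  -- slope, plus the gradient difference times W.
  have h3 : f ≤ -inner ℝ (pathGrad κ Ybar X₀) (Xbar - X₀) := by linarith
  have h4 : f ≤ -inner ℝ (pathGrad κ Yhat X₀) (Xhat - X₀) := by linarith
  have h5 : inner ℝ (pathGrad κ Ybar X₀ - pathGrad κ Yhat X₀) (Xhat - X₀) ≤
      2 * ‖Ybar - Yhat‖ / c * W :=
    (real_inner_le_norm _ _).trans (mul_le_mul hgr hWhat (norm_nonneg _) (by positivity))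
  rw [inner_sub_left] at h5
  have h6 : -(η * inner ℝ (pathGrad κ Ybar X₀) (dir X₀)) ≤ 2 * (W ^ 2 / (c * (1 - κ))) := by
    have h8 := hgx Ybar hYbar
    have h9 : 0 ≤ W ^ 2 / (c * (1 - κ)) := by positivity
    rcases le_or_gt 0 η with hη0 | hη0
    · nlinarith [mul_nonneg hη0 (hκ'.le.trans h8.1)]
    · nlinarith [h8.2]
  have h7 := hin (pathGrad κ Ybar X₀)
  have h8 := mul_le_mul_of_nonneg_left h3 ht₁
  have h9 := mul_le_mul_of_nonneg_left h4 ht₂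
  have h10 := mul_le_mul_of_nonneg_left h5 ht₂
  have h11 : t₂ * (2 * ‖Ybar - Yhat‖ / c * W) ≤ 2 * ‖Ybar - Yhat‖ / c * W :=
    mul_le_of_le_one_left (by positivity) (by linarith)
  have h12 : f = t₁ * f + t₂ * f := by rw [← add_mul, ht, one_mul]
  have h13 : 2 * W * ‖Ybar - Yhat‖ / c = 2 * ‖Ybar - Yhat‖ / c * W := by ring
  have h14 : 2 * W ^ 2 / (c * (1 - κ)) = 2 * (W ^ 2 / (c * (1 - κ))) := by ring
  rw [h13, h14]
  linarith

/-- Two supporting ovals have the same defect at some point of the arc joining their contact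
points, and this defect is small. -/
theorem exists_crossing {n : ℕ} {κ c₁ c₂ L e : ℝ} (hκ₀ : 0 < κ) (hκ₁ : κ < 1) (hc₁ : 0 < c₁)
    (hc₂ : c₁ < c₂) {Ω S : Set (V n)} {E : V n → Set (V n)} {s : V n → V n → ℝ} {u : V n → ℝ}
    (hΩ : IsOpenInSphere Ω) (hA : HypA κ c₁ c₂ L Ω S E s) (hB : HypB κ c₁ c₂ Ω S)
    (hu : IsRefractor κ c₁ c₂ Ω S u) {xbar xhat Ybar Yhat : V n} (hxbar : xbar ∈ Ω)
    (hxhat : xhat ∈ Ω) (hYbar : Ybar ∈ subdiff κ Ω S u xbar) (hYhat : Yhat ∈ subdiff κ Ω S u xhat)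
    (he : ‖xbar - xhat‖ ≤ e) (he' : e ≤ 1 / 2)
    (hball : ∀ x : V n, ‖x‖ = 1 → ‖x - xbar‖ ≤ 2 * e → x ∈ Ω) :
    ∃ x₀ ∈ Ω, ‖x₀ - xbar‖ ≤ 2 * e ∧ ∃ f, 0 ≤ f ∧
      f ≤ 8 * (c₂ / (1 - κ)) ^ 2 / (c₁ * (1 - κ)) * e ^ 2 +
        4 * (c₂ / (1 - κ)) / c₁ * (‖Ybar - Yhat‖ * e) ∧
      (∀ x ∈ Ω, -f ≤ opticalPath κ Ybar (u x • x) - opticalPath κ Ybar (u x₀ • x₀)) ∧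
      (∀ x ∈ Ω, -f ≤ opticalPath κ Yhat (u x • x) - opticalPath κ Yhat (u x₀ • x₀)) := by
  have he0 : 0 ≤ e := (norm_nonneg _).trans he
  have h1bar := hΩ.norm_eq_one hxbar
  have h1hat := hΩ.norm_eq_one hxhat
  obtain ⟨hYbarS, hbar⟩ := (mem_subdiff_iff hκ₀ hκ₁ hc₁ hΩ hu.1).1 hYbar
  obtain ⟨hYhatS, hhat⟩ := (mem_subdiff_iff hκ₀ hκ₁ hc₁ hΩ hu.1).1 hYhat
  -- The arc is the radial projection of the chord; e ≤ 1/2 keeps the chord away from the origin.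
  let y : ℝ → V n := fun τ => (1 - τ) • xbar + τ • xhat
  have hybar : ∀ τ ∈ Set.Icc (0 : ℝ) 1, ‖xbar - y τ‖ ≤ e := by
    intro τ hτ
    have : xbar - y τ = τ • (xbar - xhat) := by simp only [y]; module
    rw [this, norm_smul, Real.norm_of_nonneg hτ.1]
    exact (mul_le_of_le_one_left (norm_nonneg _) hτ.2).trans he
  have hyhat : ∀ τ ∈ Set.Icc (0 : ℝ) 1, ‖xhat - y τ‖ ≤ e := by
    intro τ hτ
    have : xhat - y τ = (τ - 1) • (xbar - xhat) := by simp only [y]; module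
    rw [this, norm_smul, Real.norm_of_nonpos (by linarith [hτ.2])]
    exact (mul_le_of_le_one_left (norm_nonneg _) (by linarith [hτ.1])).trans he
  have hy0 : ∀ τ ∈ Set.Icc (0 : ℝ) 1, y τ ≠ 0 := by
    intro τ hτ h0
    have := hybar τ hτ
    rw [h0, sub_zero, h1bar] at this
    linarith
  have hdbar : ∀ τ ∈ Set.Icc (0 : ℝ) 1, ‖dir (y τ) - xbar‖ ≤ 2 * e := by
    intro τ hτ
    have := norm_mul_norm_dir_sub_dir_le xbar (y τ) (hy0 τ hτ)
    have h2 : dir xbar = xbar := by simp [dir, h1bar]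
    rw [h1bar, one_mul, h2, norm_sub_rev] at this
    linarith [hybar τ hτ]
  have hdhat : ∀ τ ∈ Set.Icc (0 : ℝ) 1, ‖dir (y τ) - xhat‖ ≤ 2 * e := by
    intro τ hτ
    have := norm_mul_norm_dir_sub_dir_le xhat (y τ) (hy0 τ hτ)
    have h2 : dir xhat = xhat := by simp [dir, h1hat]
    rw [h1hat, one_mul, h2, norm_sub_rev] at this
    linarith [hyhat τ hτ]
  have hmem : ∀ τ ∈ Set.Icc (0 : ℝ) 1, dir (y τ) ∈ Ω := fun τ hτ =>
    hball _ (norm_dir (hy0 τ hτ)) (hdbar τ hτ)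
  have hyc : Continuous y := by simp only [y]; fun_prop
  have hdc : ContinuousOn (fun τ => dir (y τ)) (Set.Icc 0 1) := by
    unfold dir
    exact (hyc.norm.continuousOn.inv₀ fun τ hτ => norm_ne_zero_iff.2 (hy0 τ hτ)).smul
      hyc.continuousOn
  have hgc : ContinuousOn (fun τ => u (dir (y τ)) • dir (y τ)) (Set.Icc 0 1) :=
    (continuousOn_graph hκ₀ hκ₁ hc₁ hc₂ hΩ hu).comp hdc hmem
  -- The difference of the excesses of the two optical paths over their minima; each excess vanishes
  -- at its own contact point and is nonnegative at the other, so φ changes sign.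
  let φ : ℝ → ℝ := fun τ =>
    (opticalPath κ Ybar (u (dir (y τ)) • dir (y τ)) - opticalPath κ Ybar (u xbar • xbar)) -
    (opticalPath κ Yhat (u (dir (y τ)) • dir (y τ)) - opticalPath κ Yhat (u xhat • xhat))
  have hφc : ContinuousOn φ (Set.Icc 0 1) :=
    (((continuous_opticalPath κ Ybar).comp_continuousOn hgc).sub continuousOn_const).sub
      (((continuous_opticalPath κ Yhat).comp_continuousOn hgc).sub continuousOn_const)
  have hφ0 : φ 0 ≤ 0 := by
    have : dir (y 0) = xbar := by simp [y, dir, h1bar]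
    simp only [φ, this, sub_self, zero_sub, neg_nonpos, sub_nonneg]
    exact hhat xbar hxbar
  have hφ1 : 0 ≤ φ 1 := by
    have : dir (y 1) = xhat := by simp [y, dir, h1hat]
    simp only [φ, this, sub_self, sub_zero, sub_nonneg]
    exact hbar xhat hxhat
  obtain ⟨τ, hτ, hφτ⟩ := intermediate_value_Icc zero_le_one hφc ⟨hφ0, hφ1⟩
  have hx₀ := hmem τ hτ
  have hx₀bar := hdbar τ hτ
  have hx₀hat := hdhat τ hτ
  have hyτ := norm_smul_dir (y τ)
  set x₀ := dir (y τ) with hx₀d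
  refine ⟨x₀, hx₀, hx₀bar,
    opticalPath κ Ybar (u x₀ • x₀) - opticalPath κ Ybar (u xbar • xbar),
    sub_nonneg.2 (hbar x₀ hx₀), ?_, fun x hx => by linarith [hbar x hx], fun x hx => ?_⟩
  swap
  · have := hhat x hx
    simp only [φ] at hφτ
    linarith
  obtain ⟨Y₀, hY₀⟩ := hu.2 x₀ hx₀
  obtain ⟨hY₀S, h₀⟩ := (mem_subdiff_iff hκ₀ hκ₁ hc₁ hΩ hu.1).1 hY₀
  have hG := graph_mem_Gam hu hx₀
  have hn0 := (norm_mem_of_mem_Gam hc₁ hΩ hG).1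
  have hd : ∀ Y ∈ S, c₁ ≤ ‖u x₀ • x₀ - Y‖ := by
    intro Y hY
    rw [norm_sub_rev]
    exact hn0.trans (hB.le_norm_sub hκ₀ hκ₁ hA hG hY)
  have hK : 0 ≤ c₂ / (1 - κ) := div_nonneg (by linarith) (by linarith)
  have hWbar : ‖u xbar • xbar - u x₀ • x₀‖ ≤ c₂ / (1 - κ) * (2 * e) := by
    refine (norm_graph_sub_le hκ₀ hκ₁ hc₁ hΩ hu hxbar hx₀).trans ?_
    rw [norm_sub_rev]; gcongr
  have hWhat : ‖u xhat • xhat - u x₀ • x₀‖ ≤ c₂ / (1 - κ) * (2 * e) := by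
    refine (norm_graph_sub_le hκ₀ hκ₁ hc₁ hΩ hu hxhat hx₀).trans ?_
    rw [norm_sub_rev]; gcongr
  have hub : 0 < u xbar := hc₁.trans_le (hu.1 _ hxbar).1
  have huh : 0 < u xhat := hc₁.trans_le (hu.1 _ hxhat).1
  have hu0 : 0 < u x₀ := hc₁.trans_le (hu.1 _ hx₀).1
  -- Weights proportional to (1-τ)u(x̂) and τu(x̄) make the combination of u(x̄)x̄ and u(x̂)x̂ a
  -- multiple of y τ, hence a point on the ray through x₀.
  set Z := (1 - τ) * u xhat + τ * u xbar with hZ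
  have hτ1 : 0 ≤ 1 - τ := sub_nonneg.2 hτ.2
  have hZ0 : 0 < Z := by
    rcases hτ.1.eq_or_lt with h0 | h0
    · rw [hZ, ← h0]; simpa using huh
    · have := mul_nonneg hτ1 huh.le
      have := mul_pos h0 hub
      linarith
  have hdirx : dir (u x₀ • x₀) = x₀ := dir_smul_of_norm_eq_one (hΩ.norm_eq_one hx₀) hu0
  have ht : (1 - τ) * u xhat / Z + τ * u xbar / Z = 1 := by
    rw [← add_div, ← hZ, div_self hZ0.ne']
  have hη : ((1 - τ) * u xhat / Z) • (u xbar • xbar - u x₀ • x₀) +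
      (τ * u xbar / Z) • (u xhat • xhat - u x₀ • x₀) =
      (u xbar * u xhat / Z * ‖y τ‖ - u x₀) • dir (u x₀ • x₀) := by
    rw [hdirx, sub_smul, mul_smul _ ‖y τ‖, hyτ]
    have h1 : ((1 - τ) * u xhat / Z) • (u x₀ • x₀) + (τ * u xbar / Z) • (u x₀ • x₀) =
        u x₀ • x₀ := by rw [← add_smul, ht, one_smul]
    have h2 : ((1 - τ) * u xhat / Z) • (u xbar • xbar) + (τ * u xbar / Z) • (u xhat • xhat) =
        (u xbar * u xhat / Z) • y τ := by
      simp only [y, smul_add, smul_smul]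
      congr 2 <;> ring
    rw [smul_sub, smul_sub, ← h2]
    nth_rewrite 3 [← h1]
    abel
  have hfin := crossing_bound hκ₀ hκ₁ hc₁ hn0 (hd Y₀ hY₀S) (hd Ybar hYbarS) (hd Yhat hYhatS)
    hWbar hWhat (div_nonneg (mul_nonneg hτ1 huh.le) hZ0.le)
    (div_nonneg (mul_nonneg hτ.1 hub.le) hZ0.le) ht hη (h₀ xbar hxbar) (h₀ xhat hxhat) rfl
    (by simp only [φ] at hφτ; linarith)
  refine hfin.trans (le_of_eq ?_)
  ring

/-! ### Quadratic growth along the curve and covering by ∂u -/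

theorem neg_le_mul_convexComb {a β l F₁ F₂ : ℝ} (ha : 0 ≤ a) (hβ₀ : 0 ≤ β) (hβ₁ : β ≤ 1)
    (hl : l ∈ Set.Icc (0 : ℝ) 1) (h₁ : -a ≤ F₁) (h₂ : -a ≤ F₂) :
    -a ≤ β * ((1 - l) * F₁ + l * F₂) := by
  have h : -a ≤ (1 - l) * F₁ + l * F₂ := by
    linarith [mul_le_mul_of_nonneg_left h₁ (sub_nonneg.2 hl.2), mul_le_mul_of_nonneg_left h₂ hl.1]
  linarith [mul_le_mul_of_nonneg_left h hβ₀, mul_le_mul_of_nonneg_right hβ₁ ha]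

theorem growth_coeff_le {κ μ c q d m r U β : ℝ} (hκ₀ : 0 < κ) (hμκ : 0 < 1 - μ * κ) (hc : 0 < c)
    (hq : 0 < q) (hd : 0 ≤ d) (hdm : d ≤ q * m) (hm : 3 * κ / 64 * m ^ 2 ≤ 1 - β) (hU : c ≤ U) :
    3 * κ * (1 - μ * κ) * c / (128 * q ^ 2) * d ^ 2 * r ^ 2 ≤
      (1 - β) * ((1 - μ * κ) * (U * r ^ 2 / 2)) := by
  have h1 : d ^ 2 ≤ q ^ 2 * m ^ 2 := by rw [← mul_pow]; gcongr
  have h2 : 3 * κ / (64 * q ^ 2) * d ^ 2 ≤ 1 - β := by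
    refine le_trans ?_ hm
    rw [div_mul_eq_mul_div, div_le_iff₀ (by positivity)]
    linarith [mul_le_mul_of_nonneg_left h1 hκ₀.le]
  calc 3 * κ * (1 - μ * κ) * c / (128 * q ^ 2) * d ^ 2 * r ^ 2
      = (3 * κ / (64 * q ^ 2) * d ^ 2) * ((1 - μ * κ) * (c * r ^ 2 / 2)) := by field_simp; ring
    _ ≤ (1 - β) * ((1 - μ * κ) * (U * r ^ 2 / 2)) := by
      refine mul_le_mul h2 ?_ (by positivity) (le_trans (by positivity) h2)
      gcongr

section Growth

variable {n : ℕ} {κ c₁ c₂ L μ R : ℝ} {Ω S : Set (V n)} {E : V n → Set (V n)}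
  {s : V n → V n → ℝ} {u : V n → ℝ}

theorem norm_eq_one_of_mem_E (hA : HypA κ c₁ c₂ L Ω S E s) {X m : V n} (hX : X ∈ Gam Ω c₁ c₂)
    (hm : m ∈ E X) : ‖m‖ = 1 := by
  simpa [unitSphere] using (hA.dir_mem X hX m hm).1

/-- Points of the target differ in distance from X (controlled by L) and in direction (scaled by a
distance at most R + c₂). This converts the gain |m̄ - m̂|² in 1 - β into d². -/
theorem norm_sub_le_mul_dir (hc₁ : 0 < c₁) (hΩ : IsOpenInSphere Ω)
    (hS : S ⊆ Metric.closedBall 0 R) (hA : HypA κ c₁ c₂ L Ω S E s) {X Ybar Yhat : V n}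
    (hX : X ∈ Gam Ω c₁ c₂) (hYbar : Ybar ∈ S) (hYhat : Yhat ∈ S) :
    ‖Ybar - Yhat‖ ≤ (L + R + c₂) * ‖dir (Ybar - X) - dir (Yhat - X)‖ := by
  obtain ⟨b1, b2⟩ := hA.exists_dir hX hYbar
  obtain ⟨h1, h2⟩ := hA.exists_dir hX hYhat
  have hlip := hA.lipschitz X hX _ b1 _ h1
  have hm := norm_eq_one_of_mem_E hA hX b1
  rw [b2, h2] at hlip
  have hn : ‖Yhat - X‖ ≤ R + c₂ := by
    have h3 : ‖Yhat‖ ≤ R := by simpa using hS hYhat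
    have h4 := (norm_mem_of_mem_Gam hc₁ hΩ hX).2
    linarith [norm_sub_le Yhat X]
  have e : Ybar - Yhat = (‖Ybar - X‖ - ‖Yhat - X‖) • dir (Ybar - X) +
      ‖Yhat - X‖ • (dir (Ybar - X) - dir (Yhat - X)) := by
    rw [sub_smul, smul_sub, norm_smul_dir, norm_smul_dir]; abel
  have h5 := norm_add_le ((‖Ybar - X‖ - ‖Yhat - X‖) • dir (Ybar - X))
    (‖Yhat - X‖ • (dir (Ybar - X) - dir (Yhat - X)))
  rw [← e, norm_smul, norm_smul, hm, mul_one, norm_norm, Real.norm_eq_abs] at h5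
  have := mul_le_mul_of_nonneg_right hn (norm_nonneg (dir (Ybar - X) - dir (Yhat - X)))
  linarith

theorem yCurve_mem (hA : HypA κ c₁ c₂ L Ω S E s) {X Ybar Yhat : V n} (hX : X ∈ Gam Ω c₁ c₂)
    (hYbar : Ybar ∈ S) (hYhat : Yhat ∈ S) {l : ℝ} (hl : l ∈ Set.Icc (0 : ℝ) 1) :
    mCurve κ (dir X) (dir (Ybar - X)) (dir (Yhat - X)) l ∈ E X ∧
      yCurve κ s X Ybar Yhat l ∈ S := by
  have h1 : mCurve κ (dir X) (dir (Ybar - X)) (dir (Yhat - X)) l ∈ E X :=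
    hA.convex X hX _ (hA.exists_dir hX hYbar).1 _ (hA.exists_dir hX hYhat).1 ⟨l, hl, rfl⟩
  refine ⟨h1, ?_⟩
  rw [hA.graph X hX]
  exact ⟨_, h1, rfl⟩

set_option maxHeartbeats 800000 in
/-- Quadratic growth of the optical path to the points of the curve `[Ȳ, Ŷ]`. -/
theorem growth_yCurve (hκ₀ : 0 < κ) (hκ₁ : κ < 1) (hc₁ : 0 < c₁) (hL : 0 < L) (hμ : 0 ≤ μ)
    (hμκ : μ < κ) (hΩ : IsOpenInSphere Ω) (hS : S ⊆ Metric.closedBall 0 R)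
    (hA : HypA κ c₁ c₂ L Ω S E s) (hB : HypB κ c₁ c₂ Ω S) (hC : HypC κ c₁ c₂ μ Ω E s)
    (hu : IsRefractor κ c₁ c₂ Ω S u) {x₀ x Ybar Yhat : V n} (hx₀ : x₀ ∈ Ω) (hx : x ∈ Ω)
    (hYbar : Ybar ∈ S) (hYhat : Yhat ∈ S) {f l : ℝ} (hf : 0 ≤ f)
    (hfbar : -f ≤ opticalPath κ Ybar (u x • x) - opticalPath κ Ybar (u x₀ • x₀))
    (hfhat : -f ≤ opticalPath κ Yhat (u x • x) - opticalPath κ Yhat (u x₀ • x₀))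
    (hl : l ∈ Set.Icc (1 / 4 : ℝ) (3 / 4))
    {k : ℝ} (hk : k = 3 * κ * (1 - μ * κ) * c₁ / (128 * (L + R + c₂) ^ 2))
    (hsmall : 2 * ((1 + 2 * c₂ / c₁) * f) ≤ k * ‖Ybar - Yhat‖ ^ 2 * ‖x - x₀‖ ^ 2)
    (hpos : 0 < k * ‖Ybar - Yhat‖ ^ 2 * ‖x - x₀‖ ^ 2) :
    k * ‖Ybar - Yhat‖ ^ 2 * ‖x - x₀‖ ^ 2 ≤ 2 * (1 + 2 * c₂ / c₁) *
      (opticalPath κ (yCurve κ s (u x₀ • x₀) Ybar Yhat l) (u x • x) -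
        opticalPath κ (yCurve κ s (u x₀ • x₀) Ybar Yhat l) (u x₀ • x₀)) := by
  have hl' : l ∈ Set.Icc (0 : ℝ) 1 := ⟨by linarith [hl.1], by linarith [hl.2]⟩
  have hX₀ := graph_mem_Gam hu hx₀
  have hX := graph_mem_Gam hu hx
  have hu0 : 0 < u x₀ := hc₁.trans_le (hu.1 _ hx₀).1
  have hx₀1 := hΩ.norm_eq_one hx₀
  have hx1 := hΩ.norm_eq_one hx
  have hdir : dir (u x₀ • x₀) = x₀ := dir_smul_of_norm_eq_one hx₀1 hu0
  have hNX : ‖u x • x‖ = u x := norm_graph hc₁ hΩ hu hx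
  have ha := abs_norm_sub_norm_graph_le hκ₀ hκ₁ hc₁ hΩ hu hx hx₀
  have hnX₀ := norm_mem_of_mem_Gam hc₁ hΩ hX₀
  have hnX := norm_mem_of_mem_Gam hc₁ hΩ hX
  have hD : ‖u x • x - u x₀ • x₀‖ ≤ 2 * c₂ := by
    linarith [norm_sub_le (u x • x) (u x₀ • x₀)]
  have hdist : ∀ Y ∈ S, c₁ ≤ ‖Y - u x₀ • x₀‖ := fun Y hY =>
    hnX₀.1.trans (hB.le_norm_sub hκ₀ hκ₁ hA hX₀ hY)
  obtain ⟨hbE, hbs⟩ := hA.exists_dir hX₀ hYbar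
  obtain ⟨hhE, hhs⟩ := hA.exists_dir hX₀ hYhat
  obtain ⟨hmE, hYl⟩ := yCurve_mem hA hX₀ hYbar hYhat hl'
  have hCl := hC _ hX₀ _ hbE _ hhE l hl'
  rw [hbs, hhs] at hCl
  have hdd := norm_sub_le_mul_dir hc₁ hΩ hS hA hX₀ hYbar hYhat
  have hslow := hdist _ hYl
  have hspos := hA.pos _ hX₀ _ hmE
  have hml1 := norm_eq_one_of_mem_E hA hX₀ hmE
  rw [yCurve] at hslow ⊢
  rw [add_sub_cancel_left, norm_smul, hml1, mul_one, Real.norm_of_nonneg hspos.le] at hslow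
  have hR : ‖Ybar - u x₀ • x₀‖ ≤ R + c₂ := by
    have h3 : ‖Ybar‖ ≤ R := by simpa using hS hYbar
    linarith [norm_sub_le Ybar (u x₀ • x₀)]
  have hLR : 0 < L + R + c₂ := by linarith [hdist Ybar hYbar]
  have hX₀ne : u x₀ • x₀ ≠ 0 := norm_pos_iff.1 (hc₁.trans_le hnX₀.1)
  have hmb := norm_eq_one_of_mem_E hA hX₀ hbE
  have hmh := norm_eq_one_of_mem_E hA hX₀ hhE
  have hx₀d := norm_dir hX₀ne
  have hβ0 := beta_nonneg hκ₀ hκ₁ hx₀d hmb hmh hl'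
  have hβ1 := beta_le_one hκ₀ hκ₁ hx₀d hmb hmh hl'
  have hβ2 := mul_norm_sub_sq_le_one_sub_beta hκ₀ hκ₁ hx₀d hmb hmh hl hml1
  have hF := pathDefect_mCurve_ge (X := u x • x) hκ₀ hκ₁ hμ hX₀ne hβ1 ha hCl
  have hback : ∀ Y : V n, u x₀ • x₀ + ‖Y - u x₀ • x₀‖ • dir (Y - u x₀ • x₀) = Y := fun Y => by
    rw [norm_smul_dir, add_sub_cancel]
  have hFb := neg_mul_le_pathDefect (X := u x • x) hκ₀ hc₁ (hdist _ hYbar) hf hmb ha hD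
    (by rwa [hback])
  have hFh := neg_mul_le_pathDefect (X := u x • x) hκ₀ hc₁ (hdist _ hYhat) hf hmh ha hD
    (by rwa [hback])
  -- The defect of the vertex x₀/κ is, up to the factor 1 - μκ, exactly quadratic in |x - x₀|.
  have hw : ‖u x • x‖ - inner ℝ (u x • x) (dir (u x₀ • x₀)) = u x * ‖x - x₀‖ ^ 2 / 2 := by
    rw [hdir, hNX, real_inner_smul_left, norm_sub_sq_real, hx1, hx₀1]; ring
  rw [hw] at hF
  set mb := dir (Ybar - u x₀ • x₀)
  set mh := dir (Yhat - u x₀ • x₀)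
  set β := beta κ (dir (u x₀ • x₀)) mb mh l
  set ml := mCurve κ (dir (u x₀ • x₀)) mb mh l
  set Fb := pathDefect κ (u x₀ • x₀) (u x • x) mb (1 / ‖Ybar - u x₀ • x₀‖)
  set Fh := pathDefect κ (u x₀ • x₀) (u x • x) mh (1 / ‖Yhat - u x₀ • x₀‖)
  set F := pathDefect κ (u x₀ • x₀) (u x • x) ml (1 / s (u x₀ • x₀) ml) with hFdef
  set K := 1 + 2 * c₂ / c₁
  have hKf : 0 ≤ K * f := by
    have : 0 ≤ 2 * c₂ / c₁ := div_nonneg (by linarith) hc₁.le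
    have : 0 ≤ K := by simp only [K]; linarith
    positivity
  -- The vertices m̄ and m̂ lose at most K f, with K = 1 + D/c₁ and D = 2c₂; by `hsmall` this is at
  -- most half the gain `hm2` from x₀/κ.
  have hm1 : -(K * f) ≤ β * ((1 - l) * Fb + l * Fh) :=
    neg_le_mul_convexComb hKf hβ0 hβ1 hl' hFb hFh
  have hμk : 0 < 1 - μ * κ := by nlinarith
  have hm2 : k * ‖Ybar - Yhat‖ ^ 2 * ‖x - x₀‖ ^ 2 ≤
      (1 - β) * ((1 - μ * κ) * (u x * ‖x - x₀‖ ^ 2 / 2)) := by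
    rw [hk]
    exact growth_coeff_le hκ₀ hμk hc₁ hLR (norm_nonneg _) hdd hβ2 (hu.1 x hx).1
  have hFk : k * ‖Ybar - Yhat‖ ^ 2 * ‖x - x₀‖ ^ 2 ≤ 2 * F := by linarith
  have hFpos : 0 < F := by linarith
  have := le_mul_opticalPath_sub hκ₀ hc₁ hslow hml1 ha hD hFpos
  simp only [← hFdef] at this
  linarith

/-- The part of the target near the middle of `[Ȳ, Ŷ]` is covered by the subdifferential of a small
ball. -/
theorem thickening_inter_subset (hκ₀ : 0 < κ) (hκ₁ : κ < 1) (hc₁ : 0 < c₁) (hc₂ : c₁ < c₂)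
    (hL : 0 < L) (hμ : 0 ≤ μ) (hμκ : μ < κ) (hΩ : IsOpenInSphere Ω)
    (hS : S ⊆ Metric.closedBall 0 R)
    (hA : HypA κ c₁ c₂ L Ω S E s) (hB : HypB κ c₁ c₂ Ω S) (hC : HypC κ c₁ c₂ μ Ω E s)
    (hu : IsRefractor κ c₁ c₂ Ω S u) {x₀ Ybar Yhat : V n} (hx₀ : x₀ ∈ Ω)
    (hYbar : Ybar ∈ S) (hYhat : Yhat ∈ S) {f : ℝ} (hf : 0 ≤ f)
    (hfbar : ∀ x ∈ Ω, -f ≤ opticalPath κ Ybar (u x • x) - opticalPath κ Ybar (u x₀ • x₀))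
    (hfhat : ∀ x ∈ Ω, -f ≤ opticalPath κ Yhat (u x • x) - opticalPath κ Yhat (u x₀ • x₀))
    {k σ t : ℝ} (hk : k = 3 * κ * (1 - μ * κ) * c₁ / (128 * (L + R + c₂) ^ 2)) (hσ : 0 < σ)
    (hpos : 0 < k * ‖Ybar - Yhat‖ ^ 2)
    (hsmall : 2 * ((1 + 2 * c₂ / c₁) * f) ≤ k * ‖Ybar - Yhat‖ ^ 2 * σ ^ 2)
    (ht : 2 * (1 + 2 * c₂ / c₁) * (4 * t * (c₂ / (1 - κ)) / c₁) < k * ‖Ybar - Yhat‖ ^ 2 * σ)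
    (hball : ∀ x : V n, ‖x‖ = 1 → ‖x - x₀‖ ≤ σ → x ∈ Ω) :
    Metric.thickening t (yCurve κ s (u x₀ • x₀) Ybar Yhat '' Set.Icc (1 / 4 : ℝ) (3 / 4)) ∩ S ⊆
      ⋃ x ∈ Metric.ball x₀ σ ∩ unitSphere n, subdiff κ Ω S u x := by
  rintro Y ⟨hYt, hYS⟩
  rw [Metric.mem_thickening_iff] at hYt
  obtain ⟨_, ⟨l, hl, rfl⟩, hYl⟩ := hYt
  rw [dist_eq_norm] at hYl
  have hl' : l ∈ Set.Icc (0 : ℝ) 1 := ⟨by linarith [hl.1], by linarith [hl.2]⟩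
  have hX₀ := graph_mem_Gam hu hx₀
  have hnX₀ := norm_mem_of_mem_Gam hc₁ hΩ hX₀
  have ht0 : 0 ≤ t := (norm_nonneg _).trans hYl.le
  have hK : 0 < 1 + 2 * c₂ / c₁ := by
    have : 0 < c₂ := hc₁.trans hc₂
    positivity
  have hdist : c₁ ≤ ‖u x₀ • x₀ - Y‖ := by
    rw [norm_sub_rev]
    exact hnX₀.1.trans (hB.le_norm_sub hκ₀ hκ₁ hA hX₀ hYS)
  -- Outside the σ-cap the growth d²|x - x₀|² ≥ d²σ|x - x₀| beats the error O(t|x - x₀|) of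
  -- replacing Y(λ) by Y.
  have hfar : ∀ x ∈ Ω, σ ≤ ‖x - x₀‖ →
      opticalPath κ Y (u x₀ • x₀) < opticalPath κ Y (u x • x) := by
    intro x hx hσx
    have hmono : k * ‖Ybar - Yhat‖ ^ 2 * σ ^ 2 ≤ k * ‖Ybar - Yhat‖ ^ 2 * ‖x - x₀‖ ^ 2 := by
      gcongr
    have hgr := growth_yCurve hκ₀ hκ₁ hc₁ hL hμ hμκ hΩ hS hA hB hC hu hx₀ hx hYbar hYhat hf
      (hfbar x hx) (hfhat x hx) hl hk (hsmall.trans hmono) (lt_of_lt_of_le (by positivity) hmono)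
    have hch := opticalPath_sub_le (X := u x • x) hκ₀ hκ₁ hc₁ hdist hYl.le
    have hlip := norm_graph_sub_le hκ₀ hκ₁ hc₁ hΩ hu hx hx₀
    set r := ‖x - x₀‖
    set P := opticalPath κ (yCurve κ s (u x₀ • x₀) Ybar Yhat l) (u x • x) -
        opticalPath κ (yCurve κ s (u x₀ • x₀) Ybar Yhat l) (u x₀ • x₀)
    have h1 : 4 * t * ‖u x • x - u x₀ • x₀‖ / c₁ ≤ 4 * t * (c₂ / (1 - κ)) / c₁ * r := by
      rw [div_mul_eq_mul_div, mul_assoc (4 * t)]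
      gcongr
    have hr : 0 < r := hσ.trans_le hσx
    have h2 : 2 * (1 + 2 * c₂ / c₁) * (4 * t * (c₂ / (1 - κ)) / c₁) * r <
        k * ‖Ybar - Yhat‖ ^ 2 * σ * r := by gcongr
    have h3 : k * ‖Ybar - Yhat‖ ^ 2 * σ * r ≤ k * ‖Ybar - Yhat‖ ^ 2 * r ^ 2 := by
      rw [pow_two r, mul_assoc _ σ r]; gcongr
    have h4 : 2 * (1 + 2 * c₂ / c₁) * (4 * t * (c₂ / (1 - κ)) / c₁ * r) <
        2 * (1 + 2 * c₂ / c₁) * P := by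
      rw [← mul_assoc]; linarith
    have h5 := lt_of_mul_lt_mul_left h4 (by positivity)
    linarith
  have hsub : Metric.closedBall x₀ σ ∩ unitSphere n ⊆ Ω := by
    rintro x ⟨h1, h2⟩
    refine hball x (by simpa [unitSphere] using h2) ?_
    rwa [Metric.mem_closedBall, dist_eq_norm] at h1
  have hcomp : IsCompact (Metric.closedBall x₀ σ ∩ unitSphere n) :=
    (isCompact_closedBall x₀ σ).inter_right Metric.isClosed_sphere
  have hx₀s : x₀ ∈ unitSphere n := by simpa [unitSphere] using hΩ.norm_eq_one hx₀
  have hx₀m : x₀ ∈ Metric.closedBall x₀ σ ∩ unitSphere n :=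
    ⟨Metric.mem_closedBall_self hσ.le, hx₀s⟩
  -- The minimum over the closed cap is at most the value at x₀, hence is not attained on the rim
  -- and is global on Ω by `hfar`.
  obtain ⟨x₁, hx₁, hmin⟩ := hcomp.exists_isMinOn ⟨x₀, hx₀m⟩
    ((continuous_opticalPath κ Y).comp_continuousOn
      ((continuousOn_graph hκ₀ hκ₁ hc₁ hc₂ hΩ hu).mono hsub))
  have hmin' : ∀ x ∈ Metric.closedBall x₀ σ ∩ unitSphere n,
      opticalPath κ Y (u x₁ • x₁) ≤ opticalPath κ Y (u x • x) := fun x hx => hmin hx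
  have hx₁Ω := hsub hx₁
  have hx₁b : ‖x₁ - x₀‖ < σ := by
    by_contra! hcon
    exact absurd (hmin' x₀ hx₀m) (not_le.2 (hfar x₁ hx₁Ω hcon))
  refine Set.mem_biUnion (x := x₁) ⟨by rwa [Metric.mem_ball, dist_eq_norm], hx₁.2⟩ ?_
  refine (mem_subdiff_iff hκ₀ hκ₁ hc₁ hΩ hu.1).2 ⟨hYS, fun x hx => ?_⟩
  rcases le_or_gt σ ‖x - x₀‖ with h1 | h1
  · exact (hmin' x₀ hx₀m).trans (hfar x hx h1).le
  · exact hmin' x ⟨by rw [Metric.mem_closedBall, dist_eq_norm]; exact h1.le,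
      by simpa [unitSphere] using hΩ.norm_eq_one hx⟩

end Growth

/-! ### Choice of constants and the Hölder exponent -/

/-- Here N = n - 2 and t = k d²σ. Cancelling σ^N leaves d^(2N+1) ≲ σ; squaring and using σ² = q e/d
gives the exponent 2(2N+1) + 1 = 4N + 3. -/
theorem pow_le_of_measure_bound {A M k d σ q e : ℝ} {N : ℕ} (hA : 0 < A) (hk : 0 < k) (hd : 0 < d)
    (hσ : 0 < σ) (hσ2 : σ ^ 2 = q * e / d)
    (h : A * (k * d ^ 2 * σ) ^ N * d ≤ |M| * σ ^ (N + 1)) :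
    d ^ (4 * N + 3) ≤ M ^ 2 * q / (A * k ^ N) ^ 2 * e := by
  have h1 : A * k ^ N * d ^ (2 * N + 1) ≤ |M| * σ := by
    have h2 : (A * k ^ N * d ^ (2 * N + 1)) * σ ^ N ≤ |M| * σ * σ ^ N := by
      calc (A * k ^ N * d ^ (2 * N + 1)) * σ ^ N = A * (k * d ^ 2 * σ) ^ N * d := by
            rw [mul_pow, mul_pow, ← pow_mul]; ring
        _ ≤ |M| * σ ^ (N + 1) := h
        _ = |M| * σ * σ ^ N := by ring
    exact le_of_mul_le_mul_right h2 (by positivity)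
  have h2 : (A * k ^ N * d ^ (2 * N + 1)) ^ 2 ≤ (|M| * σ) ^ 2 := by gcongr
  rw [mul_pow |M|, sq_abs, hσ2, mul_pow, ← pow_mul] at h2
  have h3 : (A * k ^ N) ^ 2 * d ^ ((2 * N + 1) * 2) * d ≤ M ^ 2 * (q * e / d) * d := by gcongr
  have h4 : M ^ 2 * (q * e / d) * d = M ^ 2 * q * e := by field_simp
  rw [div_mul_eq_mul_div, le_div_iff₀ (by positivity)]
  calc d ^ (4 * N + 3) * (A * k ^ N) ^ 2 = (A * k ^ N) ^ 2 * d ^ ((2 * N + 1) * 2) * d := by ring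
    _ ≤ M ^ 2 * q * e := h3.trans_eq h4

set_option maxHeartbeats 1600000 in
/-- The power form of the Hölder estimate, with `|x̄ - x̂|` replaced by an upper bound `e`. -/
theorem exists_pow_norm_sub_le (N : ℕ) (κ c₁ c₂ L μ μ₀ A R M δ : ℝ)
    (hκ₀ : 0 < κ) (hκ₁ : κ < 1) (hc₁ : 0 < c₁) (hc₂ : c₁ < c₂) (hL : 0 < L)
    (hμ : 0 ≤ μ) (hμκ : μ < κ) (hμ₀ : 0 < μ₀) (hA : 0 < A) (hδ : 0 < δ) (hR : 0 ≤ R) :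
    ∃ C₁ : ℝ, 0 < C₁ ∧ ∃ C : ℝ, 0 < C ∧
      ∀ (Ω S : Set (V (N + 2))) (E : V (N + 2) → Set (V (N + 2)))
        (s : V (N + 2) → V (N + 2) → ℝ),
        IsOpenInSphere Ω → S ⊆ Metric.closedBall 0 R → HypA κ c₁ c₂ L Ω S E s →
        HypB κ c₁ c₂ Ω S → HypC κ c₁ c₂ μ Ω E s → HypD κ c₁ c₂ μ₀ A Ω S s →
        ∀ u : V (N + 2) → ℝ, IsRefractor κ c₁ c₂ Ω S u → MeasureBound κ M Ω S u →
          ∀ z : V (N + 2), Metric.ball z (2 * δ) ∩ unitSphere (N + 2) ⊆ Ω →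
            ∀ xbar ∈ Metric.ball z δ ∩ unitSphere (N + 2),
            ∀ xhat ∈ Metric.ball z δ ∩ unitSphere (N + 2),
            ∀ Ybar ∈ subdiff κ Ω S u xbar, ∀ Yhat ∈ subdiff κ Ω S u xhat,
            ∀ e : ℝ, 0 < e → ‖xbar - xhat‖ ≤ e → C₁ * e ≤ ‖Ybar - Yhat‖ →
              ‖Ybar - Yhat‖ ^ (4 * N + 3) ≤ C * e := by
  have hc₂0 : 0 < c₂ := hc₁.trans hc₂
  have hκ' : 0 < 1 - κ := by linarith
  have hμk : 0 < 1 - μ * κ := by nlinarith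
  obtain ⟨K, hK⟩ : ∃ K, K = c₂ / (1 - κ) := ⟨_, rfl⟩
  obtain ⟨K₃, hK₃⟩ : ∃ K₃, K₃ = 1 + 2 * c₂ / c₁ := ⟨_, rfl⟩
  obtain ⟨k, hk⟩ : ∃ k, k = 3 * κ * (1 - μ * κ) * c₁ / (128 * (L + R + c₂) ^ 2) := ⟨_, rfl⟩
  have hK0 : 0 < K := by rw [hK]; positivity
  have hK₃0 : 0 < K₃ := by rw [hK₃]; positivity
  have hk0 : 0 < k := by rw [hk]; positivity
  obtain ⟨K₂, hK₂⟩ : ∃ K₂, K₂ = 8 * K ^ 2 / (c₁ * (1 - κ)) + 4 * K / c₁ := ⟨_, rfl⟩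
  have hK₂0 : 0 < K₂ := by rw [hK₂]; positivity
  -- For t = k' d²σ the error from moving the focus is exactly half of the growth coefficient k d²σ.
  obtain ⟨k', hk'⟩ : ∃ k', k' = k * c₁ / (16 * K₃ * K) := ⟨_, rfl⟩
  have hk'0 : 0 < k' := by rw [hk']; positivity
  -- With σ² = q e/d the growth k d²σ² equals 2 K₃ K₂ d e, which absorbs twice the loss K₃ f.
  obtain ⟨q, hq⟩ : ∃ q, q = 2 * K₃ * K₂ / k := ⟨_, rfl⟩
  have hq0 : 0 < q := by rw [hq]; positivity
  -- The first entry keeps the σ-cap about x₀ inside Ω; the second gives t ≤ μ₀, as d ≤ 2R, with + 1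
  -- guarding against R = 0.
  obtain ⟨σ₀, hσ₀⟩ : ∃ σ₀, σ₀ = min (δ / 4) (μ₀ / (4 * k' * R ^ 2 + 1)) := ⟨_, rfl⟩
  have hσ₀0 : 0 < σ₀ := by rw [hσ₀]; positivity
  have hσ₀1 : σ₀ ≤ δ / 4 := by rw [hσ₀]; exact min_le_left _ _
  have hσ₀2 : 4 * k' * R ^ 2 * σ₀ ≤ μ₀ := by
    have h1 : σ₀ ≤ μ₀ / (4 * k' * R ^ 2 + 1) := by rw [hσ₀]; exact min_le_right _ _
    rw [le_div_iff₀ (by positivity)] at h1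
    linarith
  -- Since d ≤ 2R, the four terms of C₁ force in turn e ≤ d, e ≤ 1/2, 2e ≤ δ/4 and σ ≤ σ₀. The + 1
  -- in C keeps it positive when M = 0.
  refine ⟨1 + 4 * R + 16 * R / δ + q / σ₀ ^ 2, by positivity,
    M ^ 2 * q / (A * k' ^ N) ^ 2 + 1, by positivity, ?_⟩
  intro Ω S E s hΩ hS hHA hHB hHC hHD u hu hM z hz xbar hxbar xhat hxhat Ybar hYbar Yhat hYhat
    e he0 he hd
  obtain ⟨d, hdd⟩ : ∃ d, d = ‖Ybar - Yhat‖ := ⟨_, rfl⟩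
  rw [← hdd] at hd ⊢
  have hRδ : 0 ≤ 16 * R / δ := by positivity
  have hqσ : 0 ≤ q / σ₀ ^ 2 := by positivity
  have hterm : ∀ a : ℝ, a ≤ 1 + 4 * R + 16 * R / δ + q / σ₀ ^ 2 → a * e ≤ d := fun a ha =>
    (mul_le_mul_of_nonneg_right ha he0.le).trans hd
  have hd1 : e ≤ d := by
    have := hterm 1 (by linarith)
    linarith
  have hd0 : 0 < d := he0.trans_le hd1
  have hd2R : d ≤ 2 * R := by
    have h1 : ‖Ybar‖ ≤ R := by simpa using hS hYbar.1
    have h2 : ‖Yhat‖ ≤ R := by simpa using hS hYhat.1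
    rw [hdd]; linarith [norm_sub_le Ybar Yhat]
  have hR0 : 0 < R := by linarith
  have he2 : e ≤ 1 / 2 := by
    have := hterm (4 * R) (by linarith)
    nlinarith
  have heδ : 2 * e ≤ δ / 4 := by
    have h1 := hterm (16 * R / δ) (by linarith)
    rw [div_mul_eq_mul_div, div_le_iff₀ hδ] at h1
    nlinarith
  have heσ : q * e / d ≤ σ₀ ^ 2 := by
    have h1 := hterm (q / σ₀ ^ 2) (by linarith)
    rw [div_mul_eq_mul_div, div_le_iff₀ (by positivity)] at h1
    rw [div_le_iff₀ hd0]
    linarith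
  obtain ⟨σ, hσd⟩ : ∃ σ, σ = √(q * e / d) := ⟨_, rfl⟩
  have hσ2 : σ ^ 2 = q * e / d := by rw [hσd, Real.sq_sqrt (by positivity)]
  have hσ0 : 0 < σ := by rw [hσd]; positivity
  have hσσ : σ ≤ σ₀ := by rw [hσd, Real.sqrt_le_left hσ₀0.le]; exact heσ
  have hball : ∀ x : V (N + 2), ‖x‖ = 1 → ‖x - xbar‖ < δ → x ∈ Ω := by
    intro x hx hxx
    refine hz ⟨?_, by simpa [unitSphere] using hx⟩
    have h1 := hxbar.1
    rw [Metric.mem_ball] at h1 ⊢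
    rw [← dist_eq_norm] at hxx
    linarith [dist_triangle x xbar z]
  have hxbarΩ : xbar ∈ Ω :=
    hball xbar (by simpa [unitSphere] using hxbar.2) (by simpa using hδ)
  have hxhatΩ : xhat ∈ Ω := by
    refine hball xhat (by simpa [unitSphere] using hxhat.2) ?_
    rw [norm_sub_rev]; linarith
  obtain ⟨x₀, hx₀, hx₀bar, f, hf0, hf, hfbar, hfhat⟩ := exists_crossing hκ₀ hκ₁ hc₁ hc₂ hΩ hHA hHB
    hu hxbarΩ hxhatΩ hYbar hYhat he he2 (fun x hx hxx => hball x hx (by linarith))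
  have hballσ : ∀ x : V (N + 2), ‖x‖ = 1 → ‖x - x₀‖ ≤ σ → x ∈ Ω := by
    intro x hx hxx
    refine hball x hx ?_
    linarith [norm_sub_le_norm_sub_add_norm_sub x x₀ xbar]
  rw [← hK, ← hdd] at hf
  have hf' : f ≤ K₂ * (d * e) := by
    refine hf.trans ?_
    have : e ^ 2 ≤ d * e := by rw [sq]; gcongr
    rw [hK₂, add_mul]
    gcongr
  have hsub := thickening_inter_subset hκ₀ hκ₁ hc₁ hc₂ hL hμ hμκ hΩ hS hHA hHB hHC hu hx₀ hYbar.1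
    hYhat.1 hf0 hfbar hfhat hk hσ0 (by rw [← hdd]; positivity) (t := k' * d ^ 2 * σ)
    (by
      rw [← hdd, ← hK₃, hσ2]
      have h1 : k * d ^ 2 * (q * e / d) = 2 * (K₃ * (K₂ * (d * e))) := by
        rw [hq]; field_simp
      rw [h1]; gcongr)
    (by
      rw [← hdd, ← hK₃, ← hK]
      have h1 : 2 * K₃ * (4 * (k' * d ^ 2 * σ) * K / c₁) = k * d ^ 2 * σ / 2 := by
        rw [hk']; field_simp; norm_num
      rw [h1]
      exact half_lt_self (by positivity))
    hballσ
  have htμ : k' * d ^ 2 * σ ≤ μ₀ := by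
    refine le_trans ?_ hσ₀2
    have h1 : d ^ 2 ≤ 4 * R ^ 2 := by nlinarith
    calc k' * d ^ 2 * σ ≤ k' * (4 * R ^ 2) * σ₀ := by gcongr
      _ = 4 * k' * R ^ 2 * σ₀ := by ring
  have hlow := hHD _ (graph_mem_Gam hu hx₀) Ybar hYbar.1 Yhat hYhat.1 (k' * d ^ 2 * σ)
    (by positivity) htμ
  have hup := hM x₀ (by simpa [unitSphere] using hΩ.norm_eq_one hx₀) σ hσ0 (by
    rintro x ⟨h1, h2⟩
    refine hballσ x (by simpa [unitSphere] using h2) ?_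
    rw [Metric.mem_ball, dist_eq_norm] at h1
    exact h1.le)
  have hmeas := hlow.trans ((MeasureTheory.measure_mono hsub).trans hup)
  rw [← hdd] at hmeas
  have hM' : M * σ ^ (N + 2 - 1) ≤ |M| * σ ^ (N + 2 - 1) := by
    gcongr; exact le_abs_self M
  have hreal := (ENNReal.ofReal_le_ofReal_iff (by positivity)).1
    (hmeas.trans (ENNReal.ofReal_le_ofReal hM'))
  have hfin := pow_le_of_measure_bound (N := N) hA hk'0 hd0 hσ0 hσ2 hreal
  rw [add_mul, one_mul]
  linarith

end NearField

theorem theorem5p4 (n : ℕ) (hn : 2 ≤ n) (κ c₁ c₂ L μ μ₀ A R M δ : ℝ)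
    (hκ₀ : 0 < κ) (hκ₁ : κ < 1) (hc₁ : 0 < c₁) (hc₂ : c₁ < c₂) (hL : 0 < L)
    (hμ : 0 ≤ μ) (hμκ : μ < κ) (hμ₀ : 0 < μ₀) (hA : 0 < A) (hδ : 0 < δ) :
    ∃ C₁ : ℝ, 0 < C₁ ∧ ∃ C₂ : ℝ, 0 < C₂ ∧
      ∀ (Ω S : Set (NearField.V n)) (E : NearField.V n → Set (NearField.V n))
        (s : NearField.V n → NearField.V n → ℝ),
        NearField.IsOpenInSphere Ω →
        S ⊆ Metric.closedBall 0 R →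
        NearField.HypA κ c₁ c₂ L Ω S E s →
        NearField.HypB κ c₁ c₂ Ω S →
        NearField.HypC κ c₁ c₂ μ Ω E s →
        NearField.HypD κ c₁ c₂ μ₀ A Ω S s →
        ∀ u : NearField.V n → ℝ,
          NearField.IsRefractor κ c₁ c₂ Ω S u →
          NearField.MeasureBound κ M Ω S u →
          ∀ z : NearField.V n,
            Metric.ball z (2 * δ) ∩ NearField.unitSphere n ⊆ Ω →
            ∀ xbar ∈ Metric.ball z δ ∩ NearField.unitSphere n,
            ∀ xhat ∈ Metric.ball z δ ∩ NearField.unitSphere n,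
            ∀ Ybar ∈ NearField.subdiff κ Ω S u xbar,
            ∀ Yhat ∈ NearField.subdiff κ Ω S u xhat,
              C₁ * ‖xbar - xhat‖ ≤ ‖Ybar - Yhat‖ →
              ‖Ybar - Yhat‖ ≤ C₂ * ‖xbar - xhat‖ ^ (1 / (4 * (n : ℝ) - 5)) := by
  obtain ⟨N, rfl⟩ := Nat.exists_eq_add_of_le' hn
  -- R may be negative, with S empty; |R| restores nonnegativity.
  obtain ⟨C₁, hC₁, C, hC, H⟩ := NearField.exists_pow_norm_sub_le N κ c₁ c₂ L μ μ₀ A |R| M δ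
    hκ₀ hκ₁ hc₁ hc₂ hL hμ hμκ hμ₀ hA hδ (abs_nonneg R)
  have hexp : 1 / (4 * ((N + 2 : ℕ) : ℝ) - 5) = ((4 * N + 3 : ℕ) : ℝ)⁻¹ := by
    push_cast; rw [one_div]; congr 1; ring
  refine ⟨C₁, hC₁, C ^ ((4 * N + 3 : ℕ) : ℝ)⁻¹, by positivity, ?_⟩
  intro Ω S E s hΩ hS hHA hHB hHC hHD u hu hM z hz xbar hxbar xhat hxhat Ybar hYbar Yhat hYhat hd
  have H' := H Ω S E s hΩ (hS.trans (Metric.closedBall_subset_closedBall (le_abs_self R))) hHA hHB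
    hHC hHD u hu hM z hz xbar hxbar xhat hxhat Ybar hYbar Yhat hYhat
  have hpow : ‖Ybar - Yhat‖ ^ (4 * N + 3) ≤ C * ‖xbar - xhat‖ := by
    -- If x̄ = x̂, the radius σ ~ √(e/d) would vanish for e = |x̄ - x̂|. The estimate is applied
    -- instead with a positive e so small that Ȳ ≠ Ŷ would give d^(4N+3) ≤ d^(4N+3)/2.
    rcases (norm_nonneg (xbar - xhat)).eq_or_lt with h0 | h0
    · rw [← h0, mul_zero]
      by_contra! hpos
      have hd0 : 0 < ‖Ybar - Yhat‖ := by
        rcases (norm_nonneg (Ybar - Yhat)).eq_or_lt with h1 | h1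
        · rw [← h1, zero_pow (by omega)] at hpos
          exact absurd hpos (lt_irrefl _)
        · exact h1
      have h1 := H' (min (‖Ybar - Yhat‖ / C₁) (‖Ybar - Yhat‖ ^ (4 * N + 3) / (2 * C)))
        (by positivity) (by rw [← h0]; positivity) (by
          rw [mul_comm, ← le_div_iff₀ hC₁]; exact min_le_left _ _)
      have h2 := h1.trans (mul_le_mul_of_nonneg_left (min_le_right _ _) hC.le)
      have h3 : C * (‖Ybar - Yhat‖ ^ (4 * N + 3) / (2 * C)) = ‖Ybar - Yhat‖ ^ (4 * N + 3) / 2 := by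
        field_simp
      linarith
    · exact H' _ h0 le_rfl hd
  rw [hexp, ← Real.mul_rpow hC.le (norm_nonneg _),
    Real.le_rpow_inv_iff_of_pos (norm_nonneg _) (by positivity) (by positivity),
    Real.rpow_natCast]
  exact hpow
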